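/- Let $U,H$ be separable real Hilbert spaces, let $A:\mathrm{Dom}(A)\subseteq H\to H$ be the infinitesimal generator of a compact strongly continuous semigroup $\{e^{tA}\}_{t\ge 0}$ on $H$ (that is, $e^{tA}$ is a compact operator for every $t>0$), and let $\mathcal V,G\in\mathcal L(U;H)$. Set $Q_t:=\int_0^t e^{sA}GG^*e^{sA^*}\,ds$ for $t>0$ and assume: (a) there is $\eta\in(0,1)$ such that $\int_0^t s^{-\eta}\,\mathrm{Trace}_H\big[e^{sA}GG^*e^{sA^*}\big]\,ds<\infty$ for every $t>0$; (b) there are finite-dimensional subspaces $\{0\}=H_0\subseteq H_1\subseteq H_2\subseteq\cdots$ of $H$, all contained in $\mathrm{Dom}(A)\cap\mathrm{Dom}(A^*)$, with $\overline{\bigcup_n H_n}=H$ and $A(H_n\setminus H_{n-1})\subseteq (H_n\setminus H_{n-1})\cup\{0\}$ for every $n\ge 1$; (c) for every $t>0$, $e^{tA}(H)\subseteq Q_t^{1/2}(H)$ and $\int_0^t\|\Gamma_s\mathcal V\|_{\mathcal L(U;H)}\,ds<\infty$, where $\Gamma_s:=Q_s^{-1/2}e^{sA}$ and $Q_s^{-1/2}$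 denotes the pseudo-inverse of $Q_s^{1/2}$. For $t>0$ and $\varphi:H\to\mathbb R$ bounded and Borel, let $(R(t)\varphi)(x)=\int_H\varphi(e^{tA}x+y)\,\mu_t(dy)$, where $\mu_t$ is the Gaussian measure on $H$ with mean $0$ and covariance operator $Q_t$. Write $UC_b$ for spaces of bounded uniformly continuous functions and $\|\cdot\|_\infty$ for the supremum norm. A function $f\in UC_b(H)=UC_b(H;\mathbb R)$ is $\mathcal V$-differentiable at $x\in H$ with $\mathcal V$-gradient $\nabla_{\mathcal V}f(x)=\ell\in U$ if $\lim_{s\to0}\big|\frac{f(x+s\mathcal Vv)-f(x)}{s}-\langle \ell,v\rangle_U\big|=0$ for every $v\in U$; $C^1_{b,\mathcal V}(H)$ is the space of all $f\in UC_b(H)$ that are $\mathcal V$-differentiable at every point with $\nabla_{\mathcal V}f\in UC_b(H;U)$, with norm $\|f\|_{C^1_{b,\mathcal V}(H)}=\|f\|_\infty+\|\nabla_{\mathcal V}f\|_\infty$. Proposition. Let $B\in UC_b(H;U)$. There exists $\lambda_0>0$ such that for every $\lambda>\lambda_0$ and every $g\in UC_b(H)$ the equation $$u(x)=\int_0^\infty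 e^{-\lambda t}\,R(t)\big[\langle\nabla_{\mathcal V}u,B\rangle_U+g\big](x)\,dt,\qquad x\in H,$$ has a unique solution $u_\lambda\in C^1_{b,\mathcal V}(H)$ (the integrals converging absolutely), and $\|u_\lambda\|_{C^1_{b,\mathcal V}(H)}\le\|g\|_\infty$. -/

import Mathlib

open MeasureTheory ProbabilityTheory Filter Topology Set
open scoped ENNReal RealInnerProductSpace

namespace WeakUniq

/-! ### Semigroups and generators -/

section Semigroup

variable {H : Type*} [NormedAddCommGroup H] [NormedSpace ℝ H]

/-- `T` is a strongly continuous (C₀-)semigroup of bounded operators: `T 0 = I`,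
`T (s + t) = T s T t` for `s, t ≥ 0`, and every orbit `t ↦ T t x` is continuous on `[0, ∞)`.
The values of `T` at negative times play no role. -/
structure IsC0Semigroup (T : ℝ → H →L[ℝ] H) : Prop where
  map_zero : T 0 = ContinuousLinearMap.id ℝ H
  map_add : ∀ s t : ℝ, 0 ≤ s → 0 ≤ t → T (s + t) = (T s).comp (T t)
  continuousOn_orbit : ∀ x : H, ContinuousOn (fun t => T t x) (Ici 0)

/-- The (possibly unbounded) operator `A` is the infinitesimal generator of `T`: `Dom A` is the
set of all `x` for which `lim_{t → 0+} (T t x - x) / t` exists, and `A x` is that limit. -/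
def IsGenerator (A : H →ₗ.[ℝ] H) (T : ℝ → H →L[ℝ] H) : Prop :=
  ∀ x y : H, (x, y) ∈ A.graph ↔
    Tendsto (fun t : ℝ => t⁻¹ • (T t x - x)) (𝓝[>] 0) (𝓝 y)

variable [CompleteSpace H]

theorem IsC0Semigroup.exists_bound {T : ℝ → H →L[ℝ] H} (hT : IsC0Semigroup T) (t : ℝ) :
    ∃ C, ∀ s ∈ Icc 0 t, ‖T s‖ ≤ C := by
  obtain ⟨C, hC⟩ := banach_steinhaus (g := fun s : Icc (0 : ℝ) t => T s) (fun x => by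
    obtain ⟨C, hC⟩ := (isCompact_Icc (a := (0 : ℝ)) (b := t)).exists_bound_of_continuousOn
      ((hT.continuousOn_orbit x).mono Icc_subset_Ici_self)
    exact ⟨C, fun s => hC s s.2⟩)
  exact ⟨C, fun s hs => hC ⟨s, hs⟩⟩

/-- Strong convergence of a bounded family is uniform on compact sets. -/
theorem IsC0Semigroup.tendsto_comp_compact {T : ℝ → H →L[ℝ] H} (hT : IsC0Semigroup T)
    {S : H →L[ℝ] H} (hS : IsCompactOperator S) :
    Tendsto (fun h => ‖(T h).comp S - S‖) (𝓝[≥] 0) (𝓝 0) := by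
  obtain ⟨C, hC⟩ := hT.exists_bound 1
  have hC0 : 0 ≤ C := (norm_nonneg _).trans (hC 0 ⟨le_rfl, zero_le_one⟩)
  obtain ⟨K, hK, hSK⟩ := hS.image_closedBall_subset_compact (𝕜₁ := ℝ) (f := (S : H →ₗ[ℝ] H)) 1
  rw [Metric.tendsto_nhds]
  intro ε hε
  set δ := ε / (2 * (C + 2)) with hδ
  have hδ0 : 0 < δ := by positivity
  obtain ⟨F, -, hF, hKF⟩ := hK.elim_finite_subcover_image (b := univ)
    (c := fun y : H => Metric.ball y δ) (fun _ _ => Metric.isOpen_ball)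
    (fun y _ => by simpa using ⟨y, Metric.mem_ball_self hδ0⟩)
  have h1 : ∀ᶠ h in 𝓝[≥] (0 : ℝ), ∀ y ∈ F, ‖T h y - y‖ < δ := by
    rw [eventually_all_finite hF]
    intro y _
    have h2 : Tendsto (fun h => T h y) (𝓝[≥] 0) (𝓝 y) := by
      have := (hT.continuousOn_orbit y) 0 self_mem_Ici
      simpa [ContinuousWithinAt, hT.map_zero] using this
    simpa [dist_eq_norm] using (Metric.tendsto_nhds.1 h2) δ hδ0
  have h3 : ∀ᶠ h in 𝓝[≥] (0 : ℝ), h ∈ Icc (0 : ℝ) 1 := Icc_mem_nhdsGE zero_lt_one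
  filter_upwards [h1, h3] with h hh hI
  rw [dist_zero_right, norm_norm]
  have hle : ‖(T h).comp S - S‖ ≤ (C + 2) * δ := by
    refine ContinuousLinearMap.opNorm_le_of_unit_norm (by positivity) fun x hx => ?_
    have hxK : S x ∈ K := hSK ⟨x, by simp [hx], rfl⟩
    obtain ⟨y, hyF, hy⟩ := mem_iUnion₂.1 (hKF hxK)
    rw [Metric.mem_ball, dist_eq_norm] at hy
    have e : ((T h).comp S - S) x = T h (S x - y) + (T h y - y) - (S x - y) := by
      simp only [sub_apply, ContinuousLinearMap.comp_apply, map_sub]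
      abel
    rw [e]
    have b1 : ‖T h (S x - y)‖ ≤ C * δ :=
      ((T h).le_opNorm _).trans (mul_le_mul (hC h hI) hy.le (norm_nonneg _) hC0)
    have b2 := hh y hyF
    calc _ ≤ ‖T h (S x - y)‖ + ‖T h y - y‖ + ‖S x - y‖ :=
          (norm_sub_le _ _).trans (add_le_add (norm_add_le _ _) le_rfl)
      _ ≤ (C + 2) * δ := by linarith
  refine hle.trans_lt ?_
  rw [hδ]
  have : 0 < C + 2 := by positivity
  field_simp
  linarith

/-- A compact strongly continuous semigroup is norm continuous at positive times. -/
theorem IsC0Semigroup.continuousOn_norm {T : ℝ → H →L[ℝ] H} (hT : IsC0Semigroup T)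
    (hc : ∀ t : ℝ, 0 < t → IsCompactOperator (T t)) : ContinuousOn T (Ioi 0) := by
  intro t ht
  rw [mem_Ioi] at ht
  refine ContinuousAt.continuousWithinAt ?_
  obtain ⟨C, hC⟩ := hT.exists_bound (2 * t)
  have hC0 : 0 ≤ C := (norm_nonneg _).trans (hC 0 ⟨le_rfl, by linarith⟩)
  -- for `s, r` near `t` with `s ≤ r` we have `T r - T s = (T (r-s) T (t/2) - T (t/2)) T (s - t/2)`
  have key : ∀ s r, t / 2 ≤ s → s ≤ r → s ≤ 2 * t →
      ‖T r - T s‖ ≤ ‖(T (r - s)).comp (T (t / 2)) - T (t / 2)‖ * C := by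
    intro s r hs hsr hs2
    have e1 : T s = (T (t / 2)).comp (T (s - t / 2)) := by
      rw [← hT.map_add _ _ (by linarith) (by linarith)]; congr 1; ring
    have e2 : T r = (T (r - s)).comp (T s) := by
      rw [← hT.map_add _ _ (by linarith) (by linarith)]; congr 1; ring
    have e : T r - T s =
        ((T (r - s)).comp (T (t / 2)) - T (t / 2)).comp (T (s - t / 2)) := by
      rw [ContinuousLinearMap.sub_comp, ContinuousLinearMap.comp_assoc, ← e1, ← e2]
    rw [e]
    exact (ContinuousLinearMap.opNorm_comp_le _ _).trans
      (mul_le_mul_of_nonneg_left (hC _ ⟨by linarith, by linarith⟩) (norm_nonneg _))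
  have h0 := hT.tendsto_comp_compact (hc (t / 2) (by linarith))
  have habs : Tendsto (fun r : ℝ => |r - t|) (𝓝 t) (𝓝[≥] 0) := by
    refine tendsto_nhdsWithin_iff.2 ⟨?_, Eventually.of_forall fun r => mem_Ici.2 (abs_nonneg _)⟩
    have : Continuous fun r : ℝ => |r - t| := by fun_prop
    simpa using this.tendsto t
  have hlim := (h0.comp habs).mul_const C
  rw [zero_mul] at hlim
  rw [ContinuousAt, tendsto_iff_norm_sub_tendsto_zero]
  refine squeeze_zero' (Eventually.of_forall fun _ => norm_nonneg _) ?_ hlim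
  have hnear : ∀ᶠ r in 𝓝 t, r ∈ Icc (t / 2) (2 * t) :=
    Icc_mem_nhds (by linarith) (by linarith)
  filter_upwards [hnear] with r hr
  simp only [Function.comp]
  rcases le_total t r with h | h
  · rw [abs_of_nonneg (by linarith)]
    exact key t r (by linarith) h (by linarith)
  · rw [abs_of_nonpos (by linarith), norm_sub_rev, neg_sub]
    exact key r t hr.1 h hr.2

end Semigroup

/-! ### Operators on Hilbert spaces -/

section Operators

set_option linter.unusedSectionVars false

variable {H : Type*} [NormedAddCommGroup H] [InnerProductSpace ℝ H] [CompleteSpace H]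

/-- The trace in `[0, ∞]` of a positive bounded operator: the sum of `⟪S e, e⟫` over an
orthonormal (Hilbert) basis of `H`; for positive `S` it does not depend on the basis. -/
noncomputable def posTrace (S : H →L[ℝ] H) : ℝ≥0∞ :=
  ∑' e : (exists_hilbertBasis ℝ H).choose, ENNReal.ofReal ⟪S (e : H), (e : H)⟫

open Classical in
/-- The positive square root `Q^{1/2}` of a positive bounded operator `Q`: the (unique) positive
bounded operator whose square is `Q`. -/
noncomputable def posSqrt (Q : H →L[ℝ] H) : H →L[ℝ] H :=
  if h : ∃ S : H →L[ℝ] H, S.IsPositive ∧ S.comp S = Q then h.choose else 0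

theorem posSqrt_spec {Q : H →L[ℝ] H} (h : ∃ S : H →L[ℝ] H, S.IsPositive ∧ S.comp S = Q) :
    (posSqrt Q).IsPositive ∧ (posSqrt Q).comp (posSqrt Q) = Q := by
  rw [posSqrt, dif_pos h]
  exact h.choose_spec

open Classical in
/-- The pseudo-inverse `S⁻¹ : S(H) → (ker S)ᗮ` of a bounded operator `S`; it is the ordinary
inverse when `S` is injective. Off the range of `S` the value is `0`. -/
noncomputable def pseudoInv (S : H →L[ℝ] H) (y : H) : H :=
  if h : ∃ x ∈ (LinearMap.ker (S : H →ₗ[ℝ] H))ᗮ, S x = y then h.choose else 0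

theorem pseudoInv_apply (S : H →L[ℝ] H) {x : H}
    (hx : x ∈ (LinearMap.ker (S : H →ₗ[ℝ] H))ᗮ) : pseudoInv S (S x) = x := by
  have h : ∃ z ∈ (LinearMap.ker (S : H →ₗ[ℝ] H))ᗮ, S z = S x := ⟨x, hx, rfl⟩
  rw [pseudoInv, dif_pos h]
  have hk : h.choose - x ∈ LinearMap.ker (S : H →ₗ[ℝ] H) := by
    simp [h.choose_spec.2]
  have h0 := Submodule.inner_right_of_mem_orthogonal hk
    (Submodule.sub_mem _ h.choose_spec.1 hx)
  exact sub_eq_zero.1 (inner_self_eq_zero.1 h0)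

variable {U : Type*} [NormedAddCommGroup U] [InnerProductSpace ℝ U] [CompleteSpace U]

/-- The integrand `e^{sA} G G^* e^{sA^*}` of the covariance operator. -/
noncomputable def covIntegrand (T : ℝ → H →L[ℝ] H) (G : U →L[ℝ] H) (s : ℝ) : H →L[ℝ] H :=
  (T s).comp (G.comp ((ContinuousLinearMap.adjoint G).comp (ContinuousLinearMap.adjoint (T s))))

/-- The covariance operator `Q_t = ∫₀ᵗ e^{sA} G G^* e^{sA^*} ds`. For a compact strongly continuous
semigroup the integrand is bounded and norm continuous on `(0, t]`, so that this is a convergent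
Bochner integral in `L(H)`, see `covOp_apply` below. -/
noncomputable def covOp (T : ℝ → H →L[ℝ] H) (G : U →L[ℝ] H) (t : ℝ) : H →L[ℝ] H :=
  ∫ s in (0 : ℝ)..t, covIntegrand T G s

theorem covIntegrand_intervalIntegrable {T : ℝ → H →L[ℝ] H} (hT : IsC0Semigroup T)
    (hc : ∀ t : ℝ, 0 < t → IsCompactOperator (T t)) (G : U →L[ℝ] H) {t : ℝ} (ht : 0 ≤ t) :
    IntervalIntegrable (covIntegrand T G) volume 0 t := by
  rw [intervalIntegrable_iff_integrableOn_Ioc_of_le ht]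
  have hcont : ContinuousOn (covIntegrand T G) (Ioc 0 t) := by
    have h1 : ContinuousOn T (Ioc 0 t) := (hT.continuousOn_norm hc).mono Ioc_subset_Ioi_self
    have h2 : ContinuousOn (fun s => ContinuousLinearMap.adjoint (T s)) (Ioc 0 t) :=
      (LinearIsometryEquiv.continuous _).comp_continuousOn h1
    exact h1.clm_comp (continuousOn_const.clm_comp (continuousOn_const.clm_comp h2))
  obtain ⟨C, hC⟩ := hT.exists_bound t
  refine Integrable.of_bound (hcont.aestronglyMeasurable measurableSet_Ioc)
    (C * (‖G‖ * (‖G‖ * C))) ?_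
  refine (ae_restrict_iff' measurableSet_Ioc).2 (Eventually.of_forall fun s hs => ?_)
  have hs' := hC s ⟨hs.1.le, hs.2⟩
  have hC0 : 0 ≤ C := (norm_nonneg _).trans hs'
  refine (ContinuousLinearMap.opNorm_comp_le _ _).trans (mul_le_mul hs' ?_ (norm_nonneg _) hC0)
  refine (ContinuousLinearMap.opNorm_comp_le _ _).trans
    (mul_le_mul_of_nonneg_left ?_ (norm_nonneg _))
  refine (ContinuousLinearMap.opNorm_comp_le _ _).trans ?_
  rw [LinearIsometryEquiv.norm_map, LinearIsometryEquiv.norm_map]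
  exact mul_le_mul_of_nonneg_left hs' (norm_nonneg _)

/-- For a compact strongly continuous semigroup, `Q_t x = ∫₀ᵗ e^{sA} G G^* e^{sA^*} x ds`. -/
theorem covOp_apply {T : ℝ → H →L[ℝ] H} (hT : IsC0Semigroup T)
    (hc : ∀ t : ℝ, 0 < t → IsCompactOperator (T t)) (G : U →L[ℝ] H) {t : ℝ} (ht : 0 ≤ t)
    (x : H) : covOp T G t x = ∫ s in (0 : ℝ)..t, covIntegrand T G s x :=
  ContinuousLinearMap.intervalIntegral_apply (covIntegrand_intervalIntegrable hT hc G ht) x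

/-- `Γ_t = Q_t^{-1/2} e^{tA}`. -/
noncomputable def Gam (T : ℝ → H →L[ℝ] H) (G : U →L[ℝ] H) (t : ℝ) (x : H) : H :=
  pseudoInv (posSqrt (covOp T G t)) (T t x)

/-- The operator norm `‖Γ_t V‖_{L(U;H)}`, as an element of `[0, ∞]`. -/
noncomputable def normGamV (T : ℝ → H →L[ℝ] H) (G V : U →L[ℝ] H) (t : ℝ) : ℝ≥0∞ :=
  ⨆ v ∈ Metric.closedBall (0 : U) 1, ‖Gam T G t (V v)‖ₑ

end Operators

/-! ### The hypotheses -/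

section Hypotheses

variable {H U : Type*} [NormedAddCommGroup H] [InnerProductSpace ℝ H] [CompleteSpace H]
  [NormedAddCommGroup U] [InnerProductSpace ℝ U] [CompleteSpace U]

/-- The standing assumptions on the linear part: `A` generates the compact strongly continuous
semigroup `T t = e^{tA}`, and the trace condition holds for some `η ∈ (0,1)`. -/
structure StandardHyp (T : ℝ → H →L[ℝ] H) (A : H →ₗ.[ℝ] H) (G : U →L[ℝ] H) : Prop where
  semigroup : IsC0Semigroup T
  generator : IsGenerator A T
  compact : ∀ t : ℝ, 0 < t → IsCompactOperator (T t)
  trace : ∃ η : ℝ, 0 < η ∧ η < 1 ∧ ∀ t : ℝ, 0 < t →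
    ∫⁻ s in Ioc 0 t, ENNReal.ofReal (s ^ (-η)) * posTrace (covIntegrand T G s) < ∞

/-- The uniqueness hypotheses. -/
structure UniquenessHyp (T : ℝ → H →L[ℝ] H) (A : H →ₗ.[ℝ] H) (V G : U →L[ℝ] H) : Prop
    extends StandardHyp T A G where
  /-- Existence of the finite-dimensional approximating subspaces `H_n`. -/
  subspaces : ∃ Hn : ℕ → Submodule ℝ H,
    (∀ n, FiniteDimensional ℝ (Hn n)) ∧
    Dense (⋃ n, (Hn n : Set H)) ∧
    Hn 0 = ⊥ ∧
    (∀ n, Hn n ≤ Hn (n + 1)) ∧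
    (∀ n, Hn n ≤ A.domain ⊓ A.adjoint.domain) ∧
    ∀ n, ∀ x : A.domain, (x : H) ∈ Hn (n + 1) → (x : H) ∉ Hn n →
      (A x ∈ Hn (n + 1) ∧ A x ∉ Hn n) ∨ A x = 0
  /-- `e^{tA}(H) ⊆ Q_t^{1/2}(H)`. -/
  range_subset : ∀ t : ℝ, 0 < t → range (T t) ⊆ range (posSqrt (covOp T G t))
  /-- `∫₀ᵗ ‖Γ_s V‖ ds < ∞`. -/
  gam_integrable : ∀ t : ℝ, 0 < t → ∫⁻ s in Ioc 0 t, normGamV T G V s < ∞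

end Hypotheses

/-! ### The Ornstein-Uhlenbeck semigroup -/

section OU

variable {H : Type*} [NormedAddCommGroup H] [InnerProductSpace ℝ H] [CompleteSpace H]
  [MeasurableSpace H] [BorelSpace H]

/-- `μ` is the Gaussian measure with mean `0` and covariance operator `Q`. -/
def IsCenteredGaussian (Q : H →L[ℝ] H) (μ : Measure H) : Prop :=
  IsGaussian μ ∧ ∫ x, x ∂μ = 0 ∧ ∀ x y : H, covarianceBilin μ x y = ⟪Q x, y⟫

open Classical in
/-- The Gaussian measure `N(0, Q)`; it exists when `Q` is positive of trace class, and it is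
unique by `gaussianMeasure_eq`. -/
noncomputable def gaussianMeasure (Q : H →L[ℝ] H) : Measure H :=
  if h : ∃ μ : Measure H, IsCenteredGaussian Q μ then h.choose else 0

theorem gaussianMeasure_eq [SecondCountableTopology H] {Q : H →L[ℝ] H} {μ : Measure H}
    (hμ : IsCenteredGaussian Q μ) : gaussianMeasure Q = μ := by
  have h : ∃ μ : Measure H, IsCenteredGaussian Q μ := ⟨μ, hμ⟩
  rw [gaussianMeasure, dif_pos h]
  obtain ⟨h1, h2, h3⟩ := h.choose_spec
  obtain ⟨k1, k2, k3⟩ := hμ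
  refine IsGaussian.ext (by simpa using h2.trans k2.symm) ?_
  ext x y
  rw [h3, k3]

variable {U : Type*} [NormedAddCommGroup U] [InnerProductSpace ℝ U] [CompleteSpace U]

/-- The Ornstein-Uhlenbeck semigroup `(R(t)φ)(x) = ∫ φ(e^{tA}x + y) μ_t(dy)`, `μ_t = N(0, Q_t)`,
for `t > 0`. -/
noncomputable def ouSemigroup (T : ℝ → H →L[ℝ] H) (G : U →L[ℝ] H) (t : ℝ) (φ : H → ℝ)
    (x : H) : ℝ :=
  ∫ y, φ (T t x + y) ∂(gaussianMeasure (covOp T G t))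

end OU

/-! ### Function spaces -/

section FunctionSpaces

/-- `f ∈ UC_b(E; F)`: bounded and uniformly continuous. -/
def IsUCb {E F : Type*} [NormedAddCommGroup E] [NormedAddCommGroup F] (f : E → F) : Prop :=
  UniformContinuous f ∧ ∃ C : ℝ, ∀ x, ‖f x‖ ≤ C

/-- The supremum norm (of a bounded function). -/
noncomputable def supNorm {E F : Type*} [NormedAddCommGroup F] (f : E → F) : ℝ :=
  ⨆ x, ‖f x‖

variable {H U : Type*} [NormedAddCommGroup H] [InnerProductSpace ℝ H]
  [NormedAddCommGroup U] [InnerProductSpace ℝ U]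

/-- `ℓ` is the `V`-gradient of `f` at `x`: for every `v`, the limit of `(f(x + s V v) - f(x)) / s`
as `s → 0`, `s ≠ 0`, is `⟪ℓ, v⟫`. -/
def HasVGradAt (V : U →L[ℝ] H) (f : H → ℝ) (ℓ : U) (x : H) : Prop :=
  ∀ v : U, Tendsto (fun s : ℝ => |(f (x + s • V v) - f x) / s - ⟪ℓ, v⟫|) (𝓝[≠] 0) (𝓝 0)

theorem HasVGradAt.unique {V : U →L[ℝ] H} {f : H → ℝ} {ℓ ℓ' : U} {x : H}
    (h : HasVGradAt V f ℓ x) (h' : HasVGradAt V f ℓ' x) : ℓ = ℓ' := by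
  refine ext_inner_right ℝ fun v => ?_
  have a := (tendsto_zero_iff_abs_tendsto_zero _).2 (h v)
  have b := (tendsto_zero_iff_abs_tendsto_zero _).2 (h' v)
  have c := a.sub b
  simp only [sub_sub_sub_cancel_left, sub_zero] at c
  have d := tendsto_nhds_unique c tendsto_const_nhds
  linarith

open Classical in
/-- The `V`-gradient `∇_V f`. -/
noncomputable def vGrad (V : U →L[ℝ] H) (f : H → ℝ) (x : H) : U :=
  if h : ∃ ℓ : U, HasVGradAt V f ℓ x then h.choose else 0

theorem HasVGradAt.vGrad_eq {V : U →L[ℝ] H} {f : H → ℝ} {ℓ : U} {x : H}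
    (h : HasVGradAt V f ℓ x) : vGrad V f x = ℓ := by
  have h' : ∃ ℓ : U, HasVGradAt V f ℓ x := ⟨ℓ, h⟩
  rw [vGrad, dif_pos h']
  exact h'.choose_spec.unique h

/-- `f ∈ C¹_{b,V}(H)`: `f ∈ UC_b(H)` is `V`-differentiable at every point and
`∇_V f ∈ UC_b(H; U)`. -/
structure IsC1bV (V : U →L[ℝ] H) (f : H → ℝ) : Prop where
  ucb : IsUCb f
  differentiable : ∀ x : H, ∃ ℓ : U, HasVGradAt V f ℓ x
  grad_ucb : IsUCb (vGrad V f)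

/-- The norm `‖f‖_∞ + ‖∇_V f‖_∞` of `C¹_{b,V}(H)`. -/
noncomputable def c1bVNorm (V : U →L[ℝ] H) (f : H → ℝ) : ℝ :=
  supNorm f + supNorm (vGrad V f)

end FunctionSpaces

/-! ### The integral equation -/

section Equation

variable {H U : Type*} [NormedAddCommGroup H] [InnerProductSpace ℝ H] [CompleteSpace H]
  [MeasurableSpace H] [BorelSpace H]
  [NormedAddCommGroup U] [InnerProductSpace ℝ U] [CompleteSpace U]

/-- The integrand `t ↦ e^{-lam t} R(t)[⟪∇_V u, B⟫ + g](x)` of the integral equation. -/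
noncomputable def eqIntegrand (T : ℝ → H →L[ℝ] H) (V G : U →L[ℝ] H) (B : H → U) (lam : ℝ)
    (g u : H → ℝ) (x : H) (t : ℝ) : ℝ :=
  Real.exp (-lam * t) * ouSemigroup T G t (fun z => ⟪vGrad V u z, B z⟫ + g z) x

/-- `u ∈ C¹_{b,V}(H)` solves the integral equation
`u(x) = ∫₀^∞ e^{-lam t} R(t)[⟪∇_V u, B⟫ + g](x) dt` for every `x ∈ H`. -/
def IsSolution (T : ℝ → H →L[ℝ] H) (V G : U →L[ℝ] H) (B : H → U) (lam : ℝ)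
    (g u : H → ℝ) : Prop :=
  IsC1bV V u ∧ ∀ x : H, u x = ∫ t in Ioi (0 : ℝ), eqIntegrand T V G B lam g u x t

end Equation

end WeakUniq

/-!
The equation is `u = K_lam (⟪∇_V u, B⟫ + g)`, where `K_lam ψ = ∫₀^∞ e^{-lam t} R(t)ψ dt`. Setting
`ψ = ⟪∇_V u, B⟫ + g`, it is equivalent to the fixed point equation `ψ = ⟪∇_V K_lam ψ, B⟫ + g` in
`UC_b(H)`. The estimate

  `‖∇_V K_lam ψ‖_∞ ≤ C(lam) ‖ψ‖_∞`,  `C(lam) = ∫₀^∞ e^{-lam t} ‖Γ_t V‖ dt → 0` as `lam → ∞`,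

makes its right-hand side a contraction with constant `1/2` for large `lam`, and then
`‖ψ‖_∞ ≤ 2 ‖g‖_∞` and `‖u‖ ≤ (1/lam + C(lam)) ‖ψ‖_∞ ≤ ‖g‖_∞`.

*Gaussian measures.* Positive operators have norm continuous positive square roots
(`exists_continuousOn_sqrt`), by the iteration for `1 - √(1 - X)`. The trace condition makes the
square roots `S` of `Q_t` Hilbert-Schmidt, so that the series `∑ Zᵢ S eᵢ` with independent standard
Gaussian `Zᵢ` converges in mean square; its law is `N(0, Q_t)` (`exists_isCenteredGaussian`). The
partial sums depend continuously on `t`, which gives the measurability of `t ↦ R(t)ψ(x)`.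

*Smoothing.* For a unit vector `k`, `N(0, S²)` is the convolution of the law of `Z S k`, `Z` real
standard Gaussian, with another Gaussian measure (`exists_gaussian_split`). Differentiating a
Gaussian integral along `S k` is thereby a one-dimensional matter, where the derivative falls on the
Gaussian density, and it costs at most the supremum of the integrand
(`IsCenteredGaussian.hasDerivAt_integral`). As `e^{tA} V v = Q_t^{1/2} Γ_t V v`, the derivative of
`R(t)ψ` along `V v` is at most `‖Γ_t V‖ ‖v‖ ‖ψ‖_∞`, and by linearity in `ψ` it inherits the uniform
continuity of `ψ`.

*Time integrals.* From `Q_{s+t} ≥ e^{sA} Q_t e^{sA^*}` the function `t ↦ ‖Γ_t V‖` is nonincreasing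
(`UniquenessHyp.norm_Gam_antitone`). Together with its integrability near `0` this shows that
`C(lam)` is finite and tends to `0`. Dominated convergence transfers differentiability and uniform
continuity from `R(t)ψ` to `K_lam ψ`; the directional derivatives, being continuous in `x`, are
linear in the direction, and the Riesz representation theorem provides the gradient
(`vGrad_of_dirDeriv`).
-/

namespace WeakUniq

/-! ### Square roots of positive operators -/

section SquareRoot

/-- The iteration `Y₀ = 0`, `Yₙ₊₁ = (X + Yₙ²) / 2`, whose limit `Y` satisfies `(1 - Y)² = 1 - X`. -/
noncomputable def sqrtIter {A : Type*} [NormedRing A] [NormedAlgebra ℝ A] (X : A) : ℕ → A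
  | 0 => 0
  | n + 1 => (1 / 2 : ℝ) • (X + sqrtIter X n * sqrtIter X n)

theorem sqrtIter_one_mem (n : ℕ) :
    0 ≤ sqrtIter (1 : ℝ) n ∧ sqrtIter (1 : ℝ) n ≤ 1 := by
  induction n with
  | zero => simp [sqrtIter]
  | succ n ih =>
    simp only [sqrtIter, smul_eq_mul]
    constructor <;> nlinarith

variable {A : Type*} [NormedRing A] [NormedAlgebra ℝ A]

theorem commute_sqrtIter (X : A) (n m : ℕ) : Commute (sqrtIter X n) (sqrtIter X m) := by
  have h : ∀ n, Commute X (sqrtIter X n) := fun n => by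
    induction n with
    | zero => exact Commute.zero_right X
    | succ n ih => exact ((Commute.refl X).add_right (ih.mul_right ih)).smul_right _
  induction n with
  | zero => exact Commute.zero_left _
  | succ n ih => exact ((h m).add_left (ih.mul_left ih)).smul_left _

theorem continuous_sqrtIter (n : ℕ) : Continuous fun X : A => sqrtIter X n := by
  induction n with
  | zero => exact continuous_const
  | succ n ih => exact (continuous_id.add (ih.mul ih)).const_smul _

theorem norm_sqrtIter_le {X : A} (hX : ‖X‖ ≤ 1) (n : ℕ) :
    ‖sqrtIter X n‖ ≤ sqrtIter (1 : ℝ) n := by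
  induction n with
  | zero => simp [sqrtIter]
  | succ n ih =>
    simp only [sqrtIter, smul_eq_mul, norm_smul]
    have h1 : ‖sqrtIter X n * sqrtIter X n‖ ≤ sqrtIter (1 : ℝ) n * sqrtIter (1 : ℝ) n :=
      (norm_mul_le _ _).trans (mul_le_mul ih ih (norm_nonneg _) (sqrtIter_one_mem n).1)
    have h2 := norm_add_le X (sqrtIter X n * sqrtIter X n)
    norm_num
    linarith

theorem sqrtIter_succ_sub (X : A) (n : ℕ) :
    sqrtIter X (n + 1 + 1) - sqrtIter X (n + 1) = (1 / 2 : ℝ) •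
      ((sqrtIter X (n + 1) - sqrtIter X n) * (sqrtIter X (n + 1) + sqrtIter X n)) := by
  have h1 : sqrtIter X (n + 1 + 1) - sqrtIter X (n + 1) =
      (1 / 2 : ℝ) • (X + sqrtIter X (n + 1) * sqrtIter X (n + 1)) -
        (1 / 2 : ℝ) • (X + sqrtIter X n * sqrtIter X n) := rfl
  rw [h1, ← smul_sub, sub_mul, mul_add, mul_add, (commute_sqrtIter X (n + 1) n).eq]
  congr 1
  abel

/-- The increments for `X` in the unit ball are dominated by those of the scalar iteration with
`X = 1`, which is increasing and bounded. -/
theorem dist_sqrtIter_succ_le {X : A} (hX : ‖X‖ ≤ 1) (n : ℕ) :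
    ‖sqrtIter X (n + 1) - sqrtIter X n‖ ≤ sqrtIter (1 : ℝ) (n + 1) - sqrtIter (1 : ℝ) n := by
  induction n with
  | zero => simpa [sqrtIter, norm_smul] using hX
  | succ n ih =>
    rw [sqrtIter_succ_sub, sqrtIter_succ_sub, norm_smul, smul_eq_mul]
    have h1 : ‖sqrtIter X (n + 1) + sqrtIter X n‖
        ≤ sqrtIter (1 : ℝ) (n + 1) + sqrtIter (1 : ℝ) n :=
      (norm_add_le _ _).trans (add_le_add (norm_sqrtIter_le hX _) (norm_sqrtIter_le hX _))
    have h2 := mul_le_mul ih h1 (norm_nonneg _) ((norm_nonneg _).trans ih)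
    have h3 := norm_mul_le (sqrtIter X (n + 1) - sqrtIter X n) (sqrtIter X (n + 1) + sqrtIter X n)
    norm_num
    linarith

theorem exists_tendsto_sqrtIter [CompleteSpace A] : ∃ Y : A → A,
    TendstoUniformlyOn (fun n X => sqrtIter X n) Y atTop (Metric.closedBall 0 1) := by
  have hmono : Monotone (sqrtIter (1 : ℝ)) := monotone_nat_of_le_succ fun n => by
    have := (norm_nonneg _).trans (dist_sqrtIter_succ_le (X := (1 : ℝ)) (by simp) n)
    linarith
  have hcs : CauchySeq (sqrtIter (1 : ℝ)) :=
    (tendsto_atTop_ciSup hmono ⟨1, by rintro _ ⟨n, rfl⟩; exact (sqrtIter_one_mem n).2⟩).cauchySeq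
  have hdist : ∀ X : A, ‖X‖ ≤ 1 → ∀ n k, ‖sqrtIter X (n + k) - sqrtIter X n‖
      ≤ sqrtIter (1 : ℝ) (n + k) - sqrtIter (1 : ℝ) n := by
    intro X hX n k
    induction k with
    | zero => simp
    | succ k ih =>
      have h1 := dist_sqrtIter_succ_le hX (n + k)
      have h2 := norm_add_le (sqrtIter X (n + k + 1) - sqrtIter X (n + k))
        (sqrtIter X (n + k) - sqrtIter X n)
      rw [sub_add_sub_cancel] at h2
      rw [← add_assoc]
      linarith
  have huc : UniformCauchySeqOn (fun n (X : A) => sqrtIter X n) atTop (Metric.closedBall 0 1) := by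
    rw [Metric.uniformCauchySeqOn_iff]
    intro ε hε
    obtain ⟨N, hN⟩ := Metric.cauchySeq_iff.1 hcs ε hε
    refine ⟨N, fun m hm n hn X hX => ?_⟩
    have hX : ‖X‖ ≤ 1 := by simpa using hX
    rcases le_total m n with h | h
    · obtain ⟨k, rfl⟩ := Nat.exists_eq_add_of_le h
      rw [dist_comm, dist_eq_norm]
      refine (hdist X hX m k).trans_lt ((le_abs_self _).trans_lt ?_)
      simpa [Real.dist_eq] using hN _ hn _ hm
    · obtain ⟨k, rfl⟩ := Nat.exists_eq_add_of_le h
      rw [dist_eq_norm]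
      refine (hdist X hX n k).trans_lt ((le_abs_self _).trans_lt ?_)
      simpa [Real.dist_eq] using hN _ hm _ hn
  have hlim : ∀ X : A, ∃ Y, X ∈ Metric.closedBall (0 : A) 1 →
      Tendsto (fun n => sqrtIter X n) atTop (𝓝 Y) := by
    intro X
    by_cases hX : X ∈ Metric.closedBall (0 : A) 1
    · obtain ⟨Y, hY⟩ := cauchySeq_tendsto_of_complete (huc.cauchySeq hX)
      exact ⟨Y, fun _ => hY⟩
    · exact ⟨0, fun h => absurd h hX⟩
  choose Y hY using hlim
  exact ⟨Y, huc.tendstoUniformlyOn_of_tendsto fun X hX => hY X hX⟩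

variable {H : Type*} [NormedAddCommGroup H] [InnerProductSpace ℝ H]

theorem norm_one_sub_le_of_isPositive {P : H →L[ℝ] H} (hP : P.IsPositive) (h1 : ‖P‖ ≤ 1) :
    ‖1 - P‖ ≤ 1 := by
  refine ContinuousLinearMap.opNorm_le_bound _ zero_le_one fun x => ?_
  rw [one_mul, sub_apply, one_apply_eq_self]
  refine abs_le_of_sq_le_sq' ?_ (norm_nonneg _) |>.2
  have hPP : ‖P (P x)‖ ≤ ‖P x‖ := (P.le_opNorm _).trans (by nlinarith [norm_nonneg (P x)])
  have e1 : ⟪P (P x), P x⟫ ≤ ‖P x‖ ^ 2 := by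
    nlinarith [real_inner_le_norm (P (P x)) (P x), norm_nonneg (P x)]
  have e2 := hP.inner_nonneg_left (x - P x)
  have e3 : ⟪P (P x), x⟫ = ⟪P x, P x⟫ := hP.inner_left_eq_inner_right _ _
  rw [map_sub, inner_sub_left, inner_sub_right, inner_sub_right, e3,
    real_inner_self_eq_norm_sq] at e2
  rw [norm_sub_sq_real, real_inner_comm]
  nlinarith [sq_nonneg ‖P x‖]

variable [CompleteSpace H]

/-- Positive operators have positive square roots, which can be chosen to depend continuously on
the operator in the norm topology. -/
theorem exists_continuousOn_sqrt : ∃ R : (H →L[ℝ] H) → (H →L[ℝ] H),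
    ContinuousOn R {Q | Q.IsPositive} ∧
      ∀ Q : H →L[ℝ] H, Q.IsPositive → (R Q).IsPositive ∧ (R Q).comp (R Q) = Q := by
  obtain ⟨Y, hY⟩ := exists_tendsto_sqrtIter (A := H →L[ℝ] H)
  -- rescale so that the positive operator `Q / (‖Q‖ + 1)` lies in the unit ball
  let X : (H →L[ℝ] H) → (H →L[ℝ] H) := fun Q => 1 - (‖Q‖ + 1)⁻¹ • Q
  have hpos : ∀ Q : H →L[ℝ] H, 0 < ‖Q‖ + 1 := fun Q => by positivity
  have hXcont : Continuous X :=
    continuous_const.sub (((continuous_norm.add continuous_const).inv₀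
      fun Q => (hpos Q).ne').smul continuous_id)
  have hXmem : ∀ Q : H →L[ℝ] H, Q.IsPositive → X Q ∈ Metric.closedBall 0 1 := fun Q hQ => by
    rw [mem_closedBall_zero_iff]
    refine norm_one_sub_le_of_isPositive (hQ.smul_of_nonneg (inv_nonneg.2 (hpos Q).le)) ?_
    rw [norm_smul, norm_inv, Real.norm_of_nonneg (hpos Q).le, inv_mul_le_iff₀ (hpos Q)]
    linarith
  refine ⟨fun Q => √(‖Q‖ + 1) • (1 - Y (X Q)), ?_, fun Q hQ => ?_⟩
  · have hYc : ContinuousOn Y (Metric.closedBall 0 1) :=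
      hY.continuousOn (Frequently.of_forall fun n => (continuous_sqrtIter n).continuousOn)
    refine ContinuousOn.smul (f := fun Q : H →L[ℝ] H => √(‖Q‖ + 1)) (by fun_prop)
      (continuousOn_const.sub ?_)
    exact hYc.comp hXcont.continuousOn hXmem
  · have hlim := hY.tendsto_at (hXmem Q hQ)
    have hXn : ‖X Q‖ ≤ 1 := by simpa using hXmem Q hQ
    have hYn : ‖Y (X Q)‖ ≤ 1 := le_of_tendsto' hlim.norm fun n =>
      (norm_sqrtIter_le hXn n).trans (sqrtIter_one_mem n).2
    have hfix : Y (X Q) = (1 / 2 : ℝ) • (X Q + Y (X Q) * Y (X Q)) := by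
      refine tendsto_nhds_unique (hlim.comp (tendsto_add_atTop_nat 1)) ?_
      exact ((hlim.mul hlim).const_add (X Q)).const_smul (1 / 2 : ℝ)
    have hXsa : IsSelfAdjoint (X Q) :=
      (IsSelfAdjoint.one _).sub (hQ.smul_of_nonneg (inv_nonneg.2 (hpos Q).le)).isSelfAdjoint
    have hsa : IsSelfAdjoint (Y (X Q)) := by
      have : ∀ n, IsSelfAdjoint (sqrtIter (X Q) n) := fun n => by
        induction n with
        | zero => exact IsSelfAdjoint.zero _
        | succ n ih =>
          refine IsSelfAdjoint.smul (by simp [IsSelfAdjoint]) (hXsa.add ?_)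
          simpa [pow_two] using ih.pow 2
      refine tendsto_nhds_unique ((continuous_star.tendsto _).comp hlim) (hlim.congr fun n => ?_)
      exact (this n).symm
    constructor
    · refine ContinuousLinearMap.IsPositive.smul_of_nonneg ?_ (Real.sqrt_nonneg _)
      rw [ContinuousLinearMap.isPositive_def']
      refine ⟨(IsSelfAdjoint.one _).sub hsa, fun x => ?_⟩
      have h1 : ⟪Y (X Q) x, x⟫ ≤ ‖x‖ ^ 2 := by
        have h2 := (Y (X Q)).le_opNorm x
        nlinarith [real_inner_le_norm (Y (X Q) x) x, norm_nonneg x]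
      simp only [ContinuousLinearMap.reApplyInnerSelf, sub_apply, one_apply_eq_self,
        inner_sub_left, real_inner_self_eq_norm_sq, RCLike.re_to_real]
      linarith
    · change (√(‖Q‖ + 1) • (1 - Y (X Q))) * (√(‖Q‖ + 1) • (1 - Y (X Q))) = Q
      have h2 : (1 - Y (X Q)) * (1 - Y (X Q)) = 1 - X Q := by
        have : (2 : ℝ) • Y (X Q) = X Q + Y (X Q) * Y (X Q) := by
          conv_lhs => rw [hfix]
          rw [smul_smul]; norm_num
        rw [two_smul] at this
        have h3 : Y (X Q) * Y (X Q) = Y (X Q) + Y (X Q) - X Q := by rw [this]; abel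
        rw [sub_mul, mul_sub, mul_sub, h3]
        simp only [one_mul, mul_one]
        abel
      rw [smul_mul_smul_comm, h2, Real.mul_self_sqrt (hpos Q).le]
      simp only [X, sub_sub_cancel, smul_smul]
      rw [mul_inv_cancel₀ (hpos Q).ne', one_smul]

theorem posSqrt_spec_of_isPositive {Q : H →L[ℝ] H} (hQ : Q.IsPositive) :
    (posSqrt Q).IsPositive ∧ (posSqrt Q).comp (posSqrt Q) = Q := by
  obtain ⟨R, -, hR⟩ := exists_continuousOn_sqrt (H := H)
  exact posSqrt_spec ⟨R Q, hR Q hQ⟩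

end SquareRoot

/-! ### Gaussian measures on Hilbert spaces -/

section Gaussian

set_option linter.unusedSectionVars false

/-- The law on `ι → ℝ` of independent standard Gaussian coordinates. -/
noncomputable def whiteNoise (ι : Type*) : Measure (ι → ℝ) :=
  Measure.infinitePi fun _ : ι => gaussianReal 0 1

instance (ι : Type*) : IsProbabilityMeasure (whiteNoise ι) := by
  unfold whiteNoise; infer_instance

theorem whiteNoise_map_eval {ι : Type*} (i : ι) :
    (whiteNoise ι).map (fun ω => ω i) = gaussianReal 0 1 :=
  Measure.infinitePi_map_eval _ i

theorem iIndepFun_whiteNoise (ι : Type*) :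
    iIndepFun (fun (i : ι) (ω : ι → ℝ) => ω i) (whiteNoise ι) :=
  iIndepFun_infinitePi (X := fun _ : ι => id) fun _ => measurable_id

theorem memLp_whiteNoise {ι : Type*} (i : ι) : MemLp (fun ω => ω i) 2 (whiteNoise ι) := by
  have h := memLp_id_gaussianReal (μ := 0) (v := 1) 2
  rw [← whiteNoise_map_eval i] at h
  exact (memLp_map_measure_iff aestronglyMeasurable_id
    (measurable_pi_apply i).aemeasurable).1 h

theorem integral_whiteNoise_mul {ι : Type*} [DecidableEq ι] (i j : ι) :
    ∫ ω, ω i * ω j ∂(whiteNoise ι) = if i = j then 1 else 0 := by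
  have h1 : ∀ i, ∫ ω, ω i ∂(whiteNoise ι) = 0 := fun i => by
    rw [← integral_map (φ := fun ω : ι → ℝ => ω i) (f := fun x => x)
      (measurable_pi_apply i).aemeasurable aestronglyMeasurable_id, whiteNoise_map_eval]
    exact integral_id_gaussianReal
  split_ifs with h
  · subst h
    have h2 := variance_id_gaussianReal (μ := 0) (v := 1)
    rw [← whiteNoise_map_eval i, variance_map aemeasurable_id
      (measurable_pi_apply i).aemeasurable, Function.id_comp, variance_of_integral_eq_zero
      (X := fun ω : ι → ℝ => ω i) (measurable_pi_apply i).aemeasurable (h1 i)] at h2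
    simpa [pow_two] using h2
  · have := ((iIndepFun_whiteNoise ι).indepFun h).integral_fun_mul_eq_mul_integral
      (memLp_whiteNoise i).1 (memLp_whiteNoise j).1
    rw [this, h1, zero_mul]

variable {ι H : Type*} [NormedAddCommGroup H] [InnerProductSpace ℝ H]

theorem memLp_whiteNoise_smul (i : ι) (v : H) :
    MemLp (fun ω => ω i • v) 2 (whiteNoise ι) := by
  have := (ContinuousLinearMap.toSpanSingleton ℝ v).comp_memLp' (memLp_whiteNoise i)
  simpa [Function.comp_def] using this

theorem inner_whiteNoise_smul [DecidableEq ι] (i j : ι) (v w : H) :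
    ⟪(memLp_whiteNoise_smul i v).toLp, (memLp_whiteNoise_smul j w).toLp⟫
      = if i = j then ⟪v, w⟫ else 0 := by
  rw [L2.inner_def]
  have : ∀ᵐ ω ∂(whiteNoise ι), ⟪(memLp_whiteNoise_smul i v).toLp _ ω,
      (memLp_whiteNoise_smul j w).toLp _ ω⟫ = (ω i * ω j) * ⟪v, w⟫ := by
    filter_upwards [(memLp_whiteNoise_smul i v).coeFn_toLp,
      (memLp_whiteNoise_smul j w).coeFn_toLp] with ω h1 h2
    rw [h1, h2, real_inner_smul_left, real_inner_smul_right, mul_assoc]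
  rw [integral_congr_ae this, integral_mul_const, integral_whiteNoise_mul]
  split_ifs <;> simp

/-- The isometry `v ↦ Zᵢ v` into the square-integrable `H`-valued random variables, where `Zᵢ` is
the `i`-th coordinate of the white noise. -/
noncomputable def whiteNoiseIsometry (H : Type*) [NormedAddCommGroup H] [InnerProductSpace ℝ H]
    (i : ι) : H →ₗᵢ[ℝ] Lp H 2 (whiteNoise ι) where
  toFun v := (memLp_whiteNoise_smul i v).toLp
  map_add' v w := by
    rw [← MemLp.toLp_add]
    congr 1
    ext ω
    simp
  map_smul' c v := by
    rw [RingHom.id_apply, ← MemLp.toLp_const_smul]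
    congr 1
    ext ω
    exact smul_comm _ _ _
  norm_map' v := by
    classical
    have h := inner_whiteNoise_smul i i v v
    rw [if_pos rfl, real_inner_self_eq_norm_sq, real_inner_self_eq_norm_sq] at h
    exact (pow_left_inj₀ (norm_nonneg _) (norm_nonneg _) two_ne_zero).1 h

variable [CompleteSpace H]

/-- If `∑ ‖vᵢ‖² < ∞`, the random series `∑ Zᵢ vᵢ` converges in probability. -/
theorem exists_tendstoInMeasure_whiteNoise {v : ι → H} (hv : Summable fun i => ‖v i‖ ^ 2) :
    ∃ X : (ι → ℝ) → H, AEStronglyMeasurable X (whiteNoise ι) ∧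
      TendstoInMeasure (whiteNoise ι) (fun (F : Finset ι) ω => ∑ i ∈ F, ω i • v i) atTop X := by
  classical
  have hO : OrthogonalFamily ℝ (fun _ : ι => H) (whiteNoiseIsometry H) := fun i j hij v w =>
    (inner_whiteNoise_smul i j v w).trans (if_neg hij)
  obtain ⟨X, hX⟩ := (hO.summable_iff_norm_sq_summable v).2 hv
  refine ⟨X, Lp.aestronglyMeasurable X, ?_⟩
  have hX' : Tendsto (fun F : Finset ι => ∑ i ∈ F, whiteNoiseIsometry H i (v i)) atTop (𝓝 X) := hX
  refine (tendstoInMeasure_of_tendsto_Lp hX').congr_left fun F => ?_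
  have h1 : ∀ i ∈ F, ∀ᵐ ω ∂(whiteNoise ι), whiteNoiseIsometry H i (v i) ω = ω i • v i :=
    fun i _ => (memLp_whiteNoise_smul i (v i)).coeFn_toLp
  have h2 := Lp.coeFn_finsetSum F fun i => whiteNoiseIsometry H i (v i)
  filter_upwards [h2, (ae_ball_iff F.countable_toSet).2 h1] with ω h3 h4
  rw [h3, Finset.sum_apply]
  exact Finset.sum_congr rfl h4

variable [MeasurableSpace H] [BorelSpace H] [SecondCountableTopology H]

/-- A measure whose characteristic function is `z ↦ exp (-⟪Q z, z⟫ / 2)` is `N(0, Q)`. -/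
theorem isCenteredGaussian_of_charFun {Q : H →L[ℝ] H}
    (hQ : Q.IsPositive) {μ : Measure H} [IsFiniteMeasure μ]
    (h : ∀ z, charFun μ z = Complex.exp (-(⟪Q z, z⟫ / 2 : ℝ))) : IsCenteredGaussian Q μ := by
  have hf : ((innerSL ℝ (E := H)).comp Q).toBilinForm.IsPosSemidef :=
    ⟨⟨fun x y => by
      simpa [real_inner_comm] using (hQ.inner_left_eq_inner_right x y)⟩,
      ⟨fun x => by simpa using hQ.inner_nonneg_left x⟩⟩
  have h' : ∀ z, charFun μ z = Complex.exp
      ((⟪z, (0 : H)⟫ : ℝ) * Complex.I - (((innerSL ℝ (E := H)).comp Q) z z : ℝ) / 2) := fun z => by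
    rw [h]; simp
  refine ⟨isGaussian_iff_gaussian_charFun.2 ⟨0, _, hf, h'⟩, ?_, fun x y => ?_⟩
  · exact (gaussian_charFun_congr 0 _ hf h').1.symm
  · rw [← (gaussian_charFun_congr 0 _ hf h').2]
    simp

theorem IsCenteredGaussian.charFun_eq {Q : H →L[ℝ] H} {μ : Measure H}
    (h : IsCenteredGaussian Q μ) (z : H) :
    charFun μ z = Complex.exp (-(⟪Q z, z⟫ / 2 : ℝ)) := by
  obtain ⟨h1, h2, h3⟩ := h
  have h2' : μ[id] = 0 := h2
  rw [h1.charFun_eq', h2', h3]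
  congr 1
  simp

theorem measurable_whiteNoise_smul (i : ι) (v : H) : Measurable fun ω : ι → ℝ => ω i • v :=
  (ContinuousLinearMap.toSpanSingleton ℝ v).measurable.comp
    (measurable_pi_apply (X := fun _ : ι => ℝ) i)

theorem charFun_whiteNoise_sum (v : ι → H) (F : Finset ι) (z : H) :
    charFun ((whiteNoise ι).map fun ω => ∑ i ∈ F, ω i • v i) z
      = Complex.exp (-((∑ i ∈ F, ⟪v i, z⟫ ^ 2) / 2 : ℝ)) := by
  have hm : ∀ i, Measurable fun ω : ι → ℝ => ω i • v i := fun i =>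
    measurable_whiteNoise_smul i (v i)
  have hind : iIndepFun (fun (i : ι) (ω : ι → ℝ) => ω i • v i) (whiteNoise ι) :=
    (iIndepFun_whiteNoise ι).comp (fun i => ContinuousLinearMap.toSpanSingleton ℝ (v i))
      fun i => (ContinuousLinearMap.toSpanSingleton ℝ (v i)).measurable
  rw [(hind.restrict F).charFun_map_fun_finsetSum_eq_prod fun i _ => (hm i).aemeasurable,
    Finset.prod_apply]
  have h1 : ∀ i ∈ F, charFun ((whiteNoise ι).map fun ω => ω i • v i) z
      = Complex.exp (-(⟪v i, z⟫ ^ 2 / 2 : ℝ)) := fun i _ => by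
    have h2 := charFun_gaussianReal (μ := 0) (v := 1) ⟪v i, z⟫
    rw [← whiteNoise_map_eval i, charFun_apply,
      integral_map (measurable_pi_apply i).aemeasurable (by fun_prop)] at h2
    rw [charFun_apply, integral_map (hm i).aemeasurable (by fun_prop)]
    simp only [real_inner_smul_left]
    simp only [RCLike.inner_apply, conj_trivial] at h2
    simp only [mul_comm _ ⟪v _, z⟫]
    rw [h2]
    congr 1
    push_cast
    simp
  rw [Finset.prod_congr rfl h1, ← Complex.exp_sum]
  congr 1
  push_cast
  rw [Finset.sum_neg_distrib, Finset.sum_div]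

/-- For a Hilbert-Schmidt operator `S`, the law of the random series `∑ Zᵢ S eᵢ` is the Gaussian
measure with covariance `S S^*`. -/
theorem exists_isCenteredGaussian [Countable ι] (b : HilbertBasis ι ℝ H)
    {S : H →L[ℝ] H} (hS : Summable fun i => ‖S (b i)‖ ^ 2) :
    ∃ μ : Measure H, IsProbabilityMeasure μ ∧
      IsCenteredGaussian (S.comp (ContinuousLinearMap.adjoint S)) μ ∧
      ∀ ψ : BoundedContinuousFunction H ℝ,
        Tendsto (fun F : Finset ι => ∫ ω, ψ (∑ i ∈ F, ω i • S (b i)) ∂(whiteNoise ι)) atTop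
          (𝓝 (∫ x, ψ x ∂μ)) := by
  obtain ⟨X, hXm, hX⟩ := exists_tendstoInMeasure_whiteNoise hS
  have hm : ∀ F : Finset ι, Measurable fun ω : ι → ℝ => ∑ i ∈ F, ω i • S (b i) := fun F =>
    Finset.measurable_fun_sum F fun i _ => measurable_whiteNoise_smul i (S (b i))
  have hD := hX.tendstoInDistribution fun F => (hm F).aemeasurable
  have hprob : IsProbabilityMeasure ((whiteNoise ι).map X) :=
    Measure.isProbabilityMeasure_map hXm.aemeasurable
  refine ⟨(whiteNoise ι).map X, hprob, ?_, fun ψ => ?_⟩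
  · refine isCenteredGaussian_of_charFun (ContinuousLinearMap.isPositive_self_comp_adjoint S)
      fun z => ?_
    have h1 := (ProbabilityMeasure.tendsto_iff_forall_integral_rclike_tendsto ℂ).1 hD.tendsto
      (BoundedContinuousFunction.innerProbChar z)
    simp only [ProbabilityMeasure.coe_mk, ← charFun_eq_integral_innerProbChar] at h1
    refine tendsto_nhds_unique h1 ?_
    simp only [charFun_whiteNoise_sum]
    have h2 : HasSum (fun i => ⟪S (b i), z⟫ ^ 2) ⟪S.comp (ContinuousLinearMap.adjoint S) z, z⟫ := by
      have h3 := b.hasSum_inner_mul_inner (ContinuousLinearMap.adjoint S z)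
        (ContinuousLinearMap.adjoint S z)
      rw [ContinuousLinearMap.comp_apply, ← ContinuousLinearMap.adjoint_inner_right]
      refine h3.congr_fun fun i => ?_
      rw [ContinuousLinearMap.adjoint_inner_left, ContinuousLinearMap.adjoint_inner_right,
        real_inner_comm, pow_two]
    have h4 : Tendsto (fun F : Finset ι => ∑ i ∈ F, ⟪S (b i), z⟫ ^ 2) atTop
      (𝓝 ⟪S.comp (ContinuousLinearMap.adjoint S) z, z⟫) := h2
    have hc : Continuous fun r : ℝ => Complex.exp (-(r / 2 : ℝ)) := by fun_prop
    exact (hc.tendsto _).comp h4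
  · have h1 := (ProbabilityMeasure.tendsto_iff_forall_integral_tendsto.1 hD.tendsto) ψ
    simp only [ProbabilityMeasure.coe_mk] at h1
    rw [integral_map hXm.aemeasurable ψ.continuous.aestronglyMeasurable] at h1 ⊢
    refine h1.congr fun F => ?_
    rw [integral_map (hm F).aemeasurable ψ.continuous.aestronglyMeasurable]

end Gaussian

/-! ### Differentiating Gaussian integrals along a Cameron-Martin direction -/

section CameronMartin

set_option linter.unusedSectionVars false

theorem integral_gaussianReal_comp_add (f : ℝ → ℝ) (a : ℝ) :
    ∫ r, f (r + a) ∂(gaussianReal 0 1)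
      = ∫ r, f r * Real.exp (a * r - a ^ 2 / 2) ∂(gaussianReal 0 1) := by
  rw [integral_gaussianReal_eq_integral_smul one_ne_zero,
    integral_gaussianReal_eq_integral_smul one_ne_zero,
    ← integral_sub_right_eq_self (fun r => gaussianPDFReal 0 1 r • f (r + a)) a]
  refine integral_congr_ae (Eventually.of_forall fun r => ?_)
  simp only [gaussianPDFReal, smul_eq_mul, sub_add_cancel]
  rw [mul_comm (f r), ← mul_assoc, mul_assoc _ (Real.exp _) (Real.exp _), ← Real.exp_add]
  congr 3
  simp
  ring

theorem hasDerivAt_integral_gaussianReal_comp_add {f : ℝ → ℝ} (hf : Continuous f) {M : ℝ}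
    (hM : ∀ r, |f r| ≤ M) :
    HasDerivAt (fun a => ∫ r, f (r + a) ∂(gaussianReal 0 1)) (∫ r, f r * r ∂(gaussianReal 0 1))
      0 := by
  simp only [integral_gaussianReal_comp_add]
  have hM0 : 0 ≤ M := (abs_nonneg _).trans (hM 0)
  have hint : Integrable (fun r : ℝ => M * (Real.exp (2 * r) + Real.exp (-2 * r)))
      (gaussianReal 0 1) :=
    ((integrable_exp_mul_gaussianReal 2).add (integrable_exp_mul_gaussianReal (-2))).const_mul M
  have hexp : ∀ r : ℝ, Real.exp (2 * |r|) ≤ Real.exp (2 * r) + Real.exp (-2 * r) := fun r => by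
    rcases abs_cases r with ⟨h, -⟩ | ⟨h, -⟩ <;> rw [h]
    · linarith [Real.exp_pos (-2 * r)]
    · rw [mul_neg, ← neg_mul]
      linarith [Real.exp_pos (2 * r)]
  have hb : ∀ r, ∀ a ∈ Metric.ball (0 : ℝ) 1,
      ‖f r * (Real.exp (a * r - a ^ 2 / 2) * (r - a))‖
        ≤ M * (Real.exp (2 * r) + Real.exp (-2 * r)) := by
    intro r a ha
    have ha : |a| < 1 := by simpa using ha
    rw [norm_mul, norm_mul, Real.norm_eq_abs, Real.norm_eq_abs, Real.norm_eq_abs, Real.abs_exp]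
    refine mul_le_mul (hM r) ?_ (by positivity) hM0
    refine le_trans ?_ (hexp r)
    rw [two_mul, Real.exp_add]
    refine mul_le_mul (Real.exp_le_exp.2 ?_) ?_ (abs_nonneg _) (Real.exp_pos _).le
    · have : a * r ≤ |r| := (le_abs_self _).trans (by
        rw [abs_mul]; nlinarith [abs_nonneg r, abs_nonneg a])
      nlinarith [sq_nonneg a]
    · have h1 := abs_sub r a
      have h2 := Real.add_one_le_exp |r|
      linarith
  have h := hasDerivAt_integral_of_dominated_loc_of_deriv_le (μ := gaussianReal 0 1) (x₀ := (0 : ℝ))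
    (F := fun a r => f r * Real.exp (a * r - a ^ 2 / 2))
    (F' := fun a r => f r * (Real.exp (a * r - a ^ 2 / 2) * (r - a)))
    (Metric.ball_mem_nhds 0 one_pos)
    (Eventually.of_forall fun a => by fun_prop)
    ?_ (by fun_prop) (Eventually.of_forall hb) hint
    (Eventually.of_forall fun r a _ => ?_)
  · simpa using h.2
  · refine Integrable.of_bound (by fun_prop) M (Eventually.of_forall fun r => ?_)
    simpa using hM r
  · have h1 : HasDerivAt (fun a : ℝ => a * r - a ^ 2 / 2) (r - a) a := by
      have := ((hasDerivAt_id a).mul_const r).sub (((hasDerivAt_id a).pow 2).div_const 2)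
      refine this.congr_deriv ?_
      simp
    exact h1.exp.const_mul (f r)

theorem abs_integral_mul_gaussianReal_le {f : ℝ → ℝ} {M : ℝ} (hM : ∀ r, |f r| ≤ M) :
    |∫ r, f r * r ∂(gaussianReal 0 1)| ≤ M := by
  have hM0 : 0 ≤ M := (abs_nonneg _).trans (hM 0)
  have h2 : Integrable (fun r : ℝ => r ^ 2) (gaussianReal 0 1) :=
    (memLp_id_gaussianReal (μ := 0) (v := 1) 2).integrable_sq
  have hv : ∫ r, r ^ 2 ∂(gaussianReal 0 1) = 1 := by
    have := variance_id_gaussianReal (μ := 0) (v := 1)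
    rw [variance_of_integral_eq_zero aemeasurable_id integral_id_gaussianReal] at this
    simpa using this
  have h3 : Integrable (fun r : ℝ => M * ((1 + r ^ 2) / 2)) (gaussianReal 0 1) :=
    (((integrable_const 1).add h2).div_const 2).const_mul M
  rw [← Real.norm_eq_abs]
  refine (norm_integral_le_of_norm_le h3 (Eventually.of_forall fun r => ?_)).trans ?_
  · rw [norm_mul]
    refine mul_le_mul (hM r) ?_ (norm_nonneg _) hM0
    rw [Real.norm_eq_abs, ← sq_abs]
    nlinarith [sq_nonneg (|r| - 1)]
  · rw [integral_const_mul, integral_div, integral_add (integrable_const 1) h2, hv]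
    simp

variable {ι H : Type*} [NormedAddCommGroup H] [InnerProductSpace ℝ H] [CompleteSpace H]
  [MeasurableSpace H] [BorelSpace H] [SecondCountableTopology H] [Countable ι]

/-- For a unit vector `k`, the Gaussian measure `N(0, S S^*)` is the convolution of a probability
measure, namely `N(0, S (1 - k ⊗ k) S^*)`, with the law of `Z S k`, where `Z` is a standard real
Gaussian variable. -/
theorem exists_gaussian_split (b : HilbertBasis ι ℝ H) {S : H →L[ℝ] H}
    (hS : Summable fun i => ‖S (b i)‖ ^ 2) {μ : Measure H} [IsProbabilityMeasure μ]
    (hμ : IsCenteredGaussian (S.comp (ContinuousLinearMap.adjoint S)) μ) {k : H} (hk : ‖k‖ = 1) :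
    ∃ ν : Measure H, IsProbabilityMeasure ν ∧
      μ = ((gaussianReal 0 1).map fun r : ℝ => r • S k) ∗ ν := by
  let P : H →L[ℝ] H := 1 - (innerSL ℝ k).smulRight k
  have hP : ∀ x, P x = x - ⟪k, x⟫ • k := fun x => by simp [P]
  have hPadj : ContinuousLinearMap.adjoint P = P := by
    symm
    rw [ContinuousLinearMap.eq_adjoint_iff]
    intro x y
    simp only [hP, inner_sub_left, inner_sub_right, real_inner_smul_left, real_inner_smul_right]
    rw [real_inner_comm x k]
    ring
  have hPP : ∀ x, ⟪P x, P x⟫ = ⟪x, x⟫ - ⟪k, x⟫ ^ 2 := fun x => by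
    simp only [hP, inner_sub_left, inner_sub_right, real_inner_smul_left, real_inner_smul_right,
      real_inner_self_eq_norm_sq k, hk]
    rw [real_inner_comm x k]
    ring
  have hSP : Summable fun i => ‖(S.comp P) (b i)‖ ^ 2 := by
    have h1 : Summable fun i => ⟪k, b i⟫ ^ 2 := by
      refine (b.hasSum_inner_mul_inner k k).summable.congr fun i => ?_
      rw [real_inner_comm k (b i), pow_two]
    refine Summable.of_nonneg_of_le (fun i => sq_nonneg _) (fun i => ?_)
      ((hS.mul_left 2).add (h1.mul_right (2 * ‖S k‖ ^ 2)))
    rw [ContinuousLinearMap.comp_apply, hP, map_sub, map_smul]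
    have h2 := norm_sub_le (S (b i)) (⟪k, b i⟫ • S k)
    rw [norm_smul, Real.norm_eq_abs] at h2
    have h3 : ‖S (b i) - ⟪k, b i⟫ • S k‖ ^ 2 ≤ (‖S (b i)‖ + |⟪k, b i⟫| * ‖S k‖) ^ 2 :=
      pow_le_pow_left₀ (norm_nonneg _) h2 2
    have h4 := sq_abs ⟪k, b i⟫
    nlinarith [sq_nonneg (‖S (b i)‖ - |⟪k, b i⟫| * ‖S k‖)]
  obtain ⟨ν, hν, hνG, -⟩ := exists_isCenteredGaussian b hSP
  refine ⟨ν, hν, ?_⟩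
  have hm : Measurable fun r : ℝ => r • S k := by fun_prop
  have : IsProbabilityMeasure ((gaussianReal 0 1).map fun r : ℝ => r • S k) :=
    Measure.isProbabilityMeasure_map hm.aemeasurable
  refine Measure.ext_of_charFun ?_
  ext z
  rw [charFun_conv, hμ.charFun_eq, hνG.charFun_eq, charFun_apply,
    integral_map hm.aemeasurable (by fun_prop)]
  have h1 := charFun_gaussianReal (μ := 0) (v := 1) ⟪S k, z⟫
  rw [charFun_apply] at h1
  simp only [RCLike.inner_apply, conj_trivial] at h1
  simp only [real_inner_smul_left]
  simp only [mul_comm _ ⟪S k, z⟫]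
  rw [h1, ← Complex.exp_add]
  congr 1
  have h2 : ⟪(S.comp P).comp (ContinuousLinearMap.adjoint (S.comp P)) z, z⟫
      = ⟪S.comp (ContinuousLinearMap.adjoint S) z, z⟫ - ⟪S k, z⟫ ^ 2 := by
    rw [ContinuousLinearMap.comp_apply, ← ContinuousLinearMap.adjoint_inner_right,
      ContinuousLinearMap.comp_apply S, ← ContinuousLinearMap.adjoint_inner_right S,
      ContinuousLinearMap.adjoint_comp, hPadj, ContinuousLinearMap.comp_apply, hPP,
      ContinuousLinearMap.adjoint_inner_right S k z]
  rw [h2]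
  push_cast
  simp
  ring

/-- The Gaussian integral of a bounded continuous function is differentiable along every direction
`S k` in the Cameron-Martin space of `N(0, S S^*)`, with derivative bounded by `‖k‖` times the
supremum of the function. -/
theorem IsCenteredGaussian.hasDerivAt_integral (b : HilbertBasis ι ℝ H) {S : H →L[ℝ] H}
    (hS : Summable fun i => ‖S (b i)‖ ^ 2) {μ : Measure H} [IsProbabilityMeasure μ]
    (hμ : IsCenteredGaussian (S.comp (ContinuousLinearMap.adjoint S)) μ) (k : H) {χ : H → ℝ}
    (hχ : Continuous χ) {M : ℝ} (hM : ∀ x, |χ x| ≤ M) :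
    ∃ d : ℝ, HasDerivAt (fun s : ℝ => ∫ y, χ (y + s • S k) ∂μ) d 0 ∧ |d| ≤ ‖k‖ * M := by
  have hM0 : 0 ≤ M := (abs_nonneg _).trans (hM 0)
  rcases eq_or_ne k 0 with rfl | hk
  · refine ⟨0, ?_, by simp⟩
    simpa using hasDerivAt_const (0 : ℝ) (∫ y, χ y ∂μ)
  have hk0 : 0 < ‖k‖ := norm_pos_iff.2 hk
  set e : H := ‖k‖⁻¹ • k with he
  have he1 : ‖e‖ = 1 := by rw [he, norm_smul, norm_inv, norm_norm, inv_mul_cancel₀ hk0.ne']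
  have hek : S k = ‖k‖ • S e := by
    rw [he, map_smul, smul_smul, mul_inv_cancel₀ hk0.ne', one_smul]
  obtain ⟨ν, hν, hμν⟩ := exists_gaussian_split b hS hμ he1
  have hm : Measurable fun r : ℝ => r • S e := by fun_prop
  have hp : IsProbabilityMeasure ((gaussianReal 0 1).map fun r : ℝ => r • S e) :=
    Measure.isProbabilityMeasure_map hm.aemeasurable
  let f : ℝ → ℝ := fun r => ∫ y, χ (r • S e + y) ∂ν
  have hfM : ∀ r, |f r| ≤ M := fun r => by
    simpa using norm_integral_le_of_norm_le_const (μ := ν)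
      (f := fun y => χ (r • S e + y)) (Eventually.of_forall fun y => hM _)
  have hfc : Continuous f := by
    refine continuous_of_dominated (bound := fun _ => M)
      (fun r => (hχ.comp (by fun_prop)).aestronglyMeasurable)
      (fun r => Eventually.of_forall fun y => hM _) (integrable_const M)
      (Eventually.of_forall fun y => hχ.comp (by fun_prop))
  have key : ∀ s : ℝ, ∫ y, χ (y + s • S k) ∂μ = ∫ r, f (r + s * ‖k‖) ∂(gaussianReal 0 1) := by
    intro s
    have hi : ∀ κ : Measure H, IsProbabilityMeasure κ →
        Integrable (fun y => χ (y + s • S k)) κ := fun κ _ =>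
      Integrable.of_bound (hχ.comp (by fun_prop)).aestronglyMeasurable M
        (Eventually.of_forall fun y => hM _)
    rw [hμν, integral_conv (hi _ inferInstance), integral_map hm.aemeasurable]
    · refine integral_congr_ae (Eventually.of_forall fun r => ?_)
      refine integral_congr_ae (Eventually.of_forall fun y => ?_)
      simp only
      rw [hek, smul_smul, add_smul]
      congr 1
      abel
    · refine Continuous.aestronglyMeasurable (continuous_of_dominated (bound := fun _ => M)
        (fun r => (hχ.comp (by fun_prop)).aestronglyMeasurable)
        (fun r => Eventually.of_forall fun y => hM _) (integrable_const M)
        (Eventually.of_forall fun y => hχ.comp (by fun_prop)))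
  refine ⟨(∫ r, f r * r ∂(gaussianReal 0 1)) * ‖k‖, ?_, ?_⟩
  · simp only [key]
    have h1 : HasDerivAt (fun s : ℝ => s * ‖k‖) ‖k‖ 0 := by
      simpa using (hasDerivAt_id (0 : ℝ)).mul_const ‖k‖
    have h2 := hasDerivAt_integral_gaussianReal_comp_add hfc hfM
    exact HasDerivAt.comp_of_eq (0 : ℝ) h2 h1 (zero_mul _).symm
  · rw [abs_mul, abs_norm, mul_comm]
    exact mul_le_mul_of_nonneg_left (abs_integral_mul_gaussianReal_le hfM) hk0.le

end CameronMartin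

/-! ### The covariance operators `Q_t` and the measures `N(0, Q_t)` -/

section Covariance

set_option linter.unusedSectionVars false

theorem countable_of_hilbertBasis {ι H : Type*} [NormedAddCommGroup H] [InnerProductSpace ℝ H]
    [TopologicalSpace.SeparableSpace H] (b : HilbertBasis ι ℝ H) : Countable ι := by
  have hdisj : (univ : Set ι).PairwiseDisjoint fun i => Metric.ball (b i) (1 / 2) := by
    intro i _ j _ hij
    refine Metric.ball_disjoint_ball ?_
    have h1 : ‖b i - b j‖ ^ 2 = 2 := by
      rw [norm_sub_sq_real, b.orthonormal.1 i, b.orthonormal.1 j, b.orthonormal.2 hij]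
      norm_num
    rw [dist_eq_norm]
    nlinarith [norm_nonneg (b i - b j)]
  exact countable_univ_iff.1 (hdisj.countable_of_isOpen (fun _ _ => Metric.isOpen_ball)
    fun i _ => ⟨b i, Metric.mem_ball_self (by norm_num)⟩)

variable {H U : Type*} [NormedAddCommGroup H] [InnerProductSpace ℝ H] [CompleteSpace H]
  [NormedAddCommGroup U] [InnerProductSpace ℝ U] [CompleteSpace U]
  {T : ℝ → H →L[ℝ] H} {A : H →ₗ.[ℝ] H} {V G : U →L[ℝ] H}

theorem inner_covIntegrand (T : ℝ → H →L[ℝ] H) (G : U →L[ℝ] H) (s : ℝ) (x y : H) :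
    ⟪covIntegrand T G s x, y⟫ =
      ⟪ContinuousLinearMap.adjoint G (ContinuousLinearMap.adjoint (T s) x),
      ContinuousLinearMap.adjoint G (ContinuousLinearMap.adjoint (T s) y)⟫ := by
  simp only [covIntegrand, ContinuousLinearMap.comp_apply]
  rw [← ContinuousLinearMap.adjoint_inner_right, ← ContinuousLinearMap.adjoint_inner_right]

theorem StandardHyp.intervalIntegrable_inner (h : StandardHyp T A G) {t : ℝ} (ht : 0 ≤ t)
    (x y : H) : IntervalIntegrable (fun s => ⟪covIntegrand T G s x, y⟫) volume 0 t := by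
  have h1 := covIntegrand_intervalIntegrable h.semigroup h.compact G ht
  rw [intervalIntegrable_iff] at h1 ⊢
  exact (h1.apply_continuousLinearMap x).inner_const y

theorem StandardHyp.inner_covOp (h : StandardHyp T A G) {t : ℝ} (ht : 0 ≤ t) (x y : H) :
    ⟪covOp T G t x, y⟫ = ∫ s in (0 : ℝ)..t, ⟪covIntegrand T G s x, y⟫ := by
  have h1 := covIntegrand_intervalIntegrable h.semigroup h.compact G ht
  rw [covOp_apply h.semigroup h.compact G ht, intervalIntegral.integral_of_le ht,
    intervalIntegral.integral_of_le ht, real_inner_comm, ← integral_inner]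
  · simp only [real_inner_comm]
  · rw [intervalIntegrable_iff_integrableOn_Ioc_of_le ht] at h1
    exact h1.apply_continuousLinearMap x

theorem StandardHyp.isPositive_covOp (h : StandardHyp T A G) {t : ℝ} (ht : 0 ≤ t) :
    (covOp T G t).IsPositive := by
  rw [ContinuousLinearMap.isPositive_iff]
  refine ⟨fun x y => ?_, fun x => ?_⟩
  · simp only [ContinuousLinearMap.coe_coe]
    rw [real_inner_comm (covOp T G t y) x, h.inner_covOp ht, h.inner_covOp ht]
    simp only [inner_covIntegrand]
    simp only [real_inner_comm]
  · rw [h.inner_covOp ht]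
    refine intervalIntegral.integral_nonneg ht fun s _ => ?_
    rw [inner_covIntegrand]
    exact real_inner_self_nonneg

theorem StandardHyp.continuousOn_covOp (h : StandardHyp T A G) :
    ContinuousOn (covOp T G) (Ici 0) := by
  intro t ht
  rw [mem_Ici] at ht
  have h1 := intervalIntegral.continuousOn_primitive_interval'
    (covIntegrand_intervalIntegrable h.semigroup h.compact G (by linarith : 0 ≤ t + 1))
    left_mem_uIcc
  rw [uIcc_of_le (by linarith)] at h1
  refine (h1 t ⟨ht, by linarith⟩).mono_of_mem_nhdsWithin ?_
  filter_upwards [self_mem_nhdsWithin,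
    mem_nhdsWithin_of_mem_nhds (Iio_mem_nhds (lt_add_one t))] with s hs1 hs2
  exact ⟨hs1, le_of_lt hs2⟩

theorem StandardHyp.summable_inner_covOp (h : StandardHyp T A G) {t : ℝ} (ht : 0 < t) :
    Summable fun e : (exists_hilbertBasis ℝ H).choose => ⟪covOp T G t (e : H), (e : H)⟫ := by
  obtain ⟨η, hη0, -, hη⟩ := h.trace
  set I := ∫⁻ s in Ioc 0 t, posTrace (covIntegrand T G s) with hI
  have hIfin : I < ∞ := by
    -- on `(0, t]` the weight `s ^ (-η)` is at least `t ^ (-η)`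
    have h1 : ENNReal.ofReal (t ^ (-η)) * I
        ≤ ∫⁻ s in Ioc 0 t, ENNReal.ofReal (s ^ (-η)) * posTrace (covIntegrand T G s) := by
      rw [hI, ← lintegral_const_mul' _ _ ENNReal.ofReal_ne_top]
      refine setLIntegral_mono_ae' measurableSet_Ioc (Eventually.of_forall fun s hs => ?_)
      gcongr ?_ * _
      exact ENNReal.ofReal_le_ofReal
        (Real.rpow_le_rpow_of_nonpos hs.1 hs.2 (by linarith))
    have h2 : 0 < ENNReal.ofReal (t ^ (-η)) := ENNReal.ofReal_pos.2 (Real.rpow_pos_of_pos ht _)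
    by_contra hcon
    rw [not_lt, top_le_iff] at hcon
    rw [hcon, ENNReal.mul_top h2.ne'] at h1
    exact absurd (hη t ht) (not_lt.2 h1)
  refine summable_of_sum_le (c := I.toReal)
    (fun e => (h.isPositive_covOp ht.le).inner_nonneg_left _) fun F => ?_
  let q : (exists_hilbertBasis ℝ H).choose → ℝ → ℝ := fun e s => ⟪covIntegrand T G s e, (e : H)⟫
  have hnn : ∀ s e, 0 ≤ q e s := fun s e => by
    simp only [q, inner_covIntegrand]; exact real_inner_self_nonneg
  have hint : ∀ e, IntegrableOn (q e) (Ioc 0 t) := fun e =>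
    (intervalIntegrable_iff_integrableOn_Ioc_of_le ht.le).1
      (h.intervalIntegrable_inner ht.le e e)
  simp only [h.inner_covOp ht.le, intervalIntegral.integral_of_le ht.le]
  change ∑ e ∈ F, ∫ s in Ioc 0 t, q e s ≤ I.toReal
  rw [← integral_finsetSum F fun e _ => hint e, integral_eq_lintegral_of_nonneg_ae
    (Eventually.of_forall fun s => Finset.sum_nonneg fun e _ => hnn s e)
    (integrable_finsetSum F fun e _ => hint e).aestronglyMeasurable]
  refine ENNReal.toReal_mono hIfin.ne (lintegral_mono fun s => ?_)
  simp only
  rw [ENNReal.ofReal_sum_of_nonneg fun e _ => hnn s e]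
  exact ENNReal.sum_le_tsum F

theorem summable_sq_norm_of_sq_eq {ι : Type*} {b : ι → H} {S Q : H →L[ℝ] H} (hS : S.IsPositive)
    (hSQ : S.comp S = Q) (hQ : Summable fun i => ⟪Q (b i), b i⟫) :
    Summable fun i => ‖S (b i)‖ ^ 2 := by
  refine hQ.congr fun i => ?_
  rw [← hSQ, ContinuousLinearMap.comp_apply, hS.inner_left_eq_inner_right,
    real_inner_self_eq_norm_sq]

/-- There is a Hilbert basis whose images under any positive square root of any `Q_t` are
square-summable. -/
theorem StandardHyp.exists_hilbertBasis_summable (h : StandardHyp T A G) :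
    ∃ (w : Set H) (b : HilbertBasis w ℝ H), ∀ t : ℝ, 0 < t → ∀ S : H →L[ℝ] H, S.IsPositive →
      S.comp S = covOp T G t → Summable fun i => ‖S (b i)‖ ^ 2 := by
  obtain ⟨b, hb⟩ := (exists_hilbertBasis ℝ H).choose_spec
  refine ⟨_, b, fun t ht S hS hSQ => summable_sq_norm_of_sq_eq hS hSQ ?_⟩
  simpa [hb] using h.summable_inner_covOp ht

variable [TopologicalSpace.SeparableSpace H] [MeasurableSpace H] [BorelSpace H]

/-- For every positive square root `S` of `Q` which is Hilbert-Schmidt, `N(0, Q)` is the weak limit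
of the laws of the partial sums of `∑ Zᵢ S eᵢ`; in particular it exists. -/
theorem gaussianMeasure_spec {ι : Type*}
    (b : HilbertBasis ι ℝ H) {S : H →L[ℝ] H} (hS : S.IsPositive) {Q : H →L[ℝ] H}
    (hSQ : S.comp S = Q)
    (hsum : Summable fun i => ‖S (b i)‖ ^ 2) :
    IsProbabilityMeasure (gaussianMeasure Q) ∧
      IsCenteredGaussian (S.comp (ContinuousLinearMap.adjoint S))
        (gaussianMeasure Q) ∧
      ∀ ψ : BoundedContinuousFunction H ℝ,
        Tendsto (fun F : Finset ι => ∫ ω, ψ (∑ i ∈ F, ω i • S (b i)) ∂(whiteNoise ι)) atTop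
          (𝓝 (∫ x, ψ x ∂(gaussianMeasure Q))) := by
  have := countable_of_hilbertBasis b
  have : SecondCountableTopology H := UniformSpace.secondCountable_of_separable H
  obtain ⟨μ, hμ, hG, hψ⟩ := exists_isCenteredGaussian b hsum
  have hadj : S.comp (ContinuousLinearMap.adjoint S) = Q := by
    rw [hS.isSelfAdjoint.adjoint_eq, hSQ]
  rw [gaussianMeasure_eq (hadj ▸ hG)]
  exact ⟨hμ, hG, hψ⟩

theorem StandardHyp.isProbabilityMeasure (h : StandardHyp T A G) {t : ℝ} (ht : 0 < t) :
    IsProbabilityMeasure (gaussianMeasure (covOp T G t)) := by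
  obtain ⟨w, b, hb⟩ := h.exists_hilbertBasis_summable
  obtain ⟨h1, h2⟩ := posSqrt_spec_of_isPositive (h.isPositive_covOp ht.le)
  exact (gaussianMeasure_spec b h1 h2 (hb t ht _ h1 h2)).1

/-- Measurability in time of the Ornstein-Uhlenbeck semigroup: with a norm continuous choice of
`S_t = Q_t^{1/2}`, `R(t)ψ(x)` is the limit of the functions `E ψ(T_t x + ∑_{i ∈ F} Zᵢ S_t eᵢ)`,
which are continuous in `t`. -/
theorem StandardHyp.aestronglyMeasurable_ouSemigroup (h : StandardHyp T A G) {ψ : H → ℝ}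
    (hψ : Continuous ψ) {M : ℝ} (hM : ∀ x, |ψ x| ≤ M) (x : H) :
    AEStronglyMeasurable (fun t => ouSemigroup T G t ψ x) (volume.restrict (Ioi 0)) := by
  obtain ⟨w, b, hb⟩ := h.exists_hilbertBasis_summable
  have := countable_of_hilbertBasis b
  have : SecondCountableTopology H := UniformSpace.secondCountable_of_separable H
  obtain ⟨R, hRc, hR⟩ := exists_continuousOn_sqrt (H := H)
  have hpos : ∀ t : ℝ, 0 < t → (covOp T G t).IsPositive := fun t ht => h.isPositive_covOp ht.le
  have hSc : ContinuousOn (fun t => R (covOp T G t)) (Ioi 0) :=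
    hRc.comp (h.continuousOn_covOp.mono Ioi_subset_Ici_self) hpos
  have hTc : ContinuousOn (fun t => T t x) (Ioi 0) :=
    (h.semigroup.continuousOn_orbit x).mono Ioi_subset_Ici_self
  refine aestronglyMeasurable_of_tendsto_ae (atTop : Filter (Finset w))
    (f := fun F t => ∫ ω, ψ (T t x + ∑ i ∈ F, ω i • R (covOp T G t) (b i)) ∂(whiteNoise w))
    (fun F => ?_) ?_
  · refine ContinuousOn.aestronglyMeasurable ?_ measurableSet_Ioi
    refine continuousOn_of_dominated (bound := fun _ => M) (fun t ht => ?_)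
      (fun t ht => Eventually.of_forall fun ω => hM _) (integrable_const M)
      (Eventually.of_forall fun ω => ?_)
    · have : Measurable fun ω : w → ℝ => T t x + ∑ i ∈ F, ω i • R (covOp T G t) (b i) :=
        measurable_const.add
          (Finset.measurable_fun_sum F fun i _ => measurable_whiteNoise_smul i _)
      exact (hψ.measurable.comp this).aestronglyMeasurable
    · refine hψ.comp_continuousOn (hTc.add (continuousOn_finsetSum F fun i _ => ?_))
      exact continuousOn_const.smul (hSc.clm_apply continuousOn_const)
  · refine (ae_restrict_iff' measurableSet_Ioi).2 (Eventually.of_forall fun t ht => ?_)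
    obtain ⟨hS, hSQ⟩ := hR _ (hpos t ht)
    exact (gaussianMeasure_spec b hS hSQ (hb t ht _ hS hSQ)).2.2
      (BoundedContinuousFunction.ofNormedAddCommGroup (fun y => ψ (T t x + y))
        (hψ.comp (by fun_prop)) M fun y => hM _)

end Covariance

/-! ### The operators `Γ_t` -/

section Gamma

variable {H U : Type*} [NormedAddCommGroup H] [InnerProductSpace ℝ H] [CompleteSpace H]
  [NormedAddCommGroup U] [InnerProductSpace ℝ U] [CompleteSpace U]
  {T : ℝ → H →L[ℝ] H} {A : H →ₗ.[ℝ] H} {V G : U →L[ℝ] H}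

theorem pseudoInv_spec {S : H →L[ℝ] H} {y : H} (hy : y ∈ range S) :
    pseudoInv S y ∈ (LinearMap.ker (S : H →ₗ[ℝ] H))ᗮ ∧ S (pseudoInv S y) = y := by
  have hcl : IsClosed (LinearMap.ker (S : H →ₗ[ℝ] H) : Set H) :=
    ContinuousLinearMap.isClosed_ker S
  have : CompleteSpace (LinearMap.ker (S : H →ₗ[ℝ] H)) := hcl.completeSpace_coe
  obtain ⟨x, rfl⟩ := hy
  obtain ⟨u, hu, v, hv, rfl⟩ := Submodule.exists_add_mem_mem_orthogonal
    (K := LinearMap.ker (S : H →ₗ[ℝ] H)) x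
  have hu' : S u = 0 := hu
  rw [map_add, hu', zero_add, pseudoInv_apply S hv]
  exact ⟨hv, rfl⟩

theorem pseudoInv_smul {S : H →L[ℝ] H} {y : H} (hy : y ∈ range S) (c : ℝ) :
    pseudoInv S (c • y) = c • pseudoInv S y := by
  obtain ⟨h1, h2⟩ := pseudoInv_spec hy
  conv_lhs => rw [← h2, ← map_smul]
  exact pseudoInv_apply S (Submodule.smul_mem _ c h1)

/-- The norm of an element of `(ker S)ᗮ = closure (range S)` can be tested against `range S`. -/
theorem norm_le_of_inner_le {S : H →L[ℝ] H} (hS : IsSelfAdjoint S) {k : H}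
    (hk : k ∈ (LinearMap.ker (S : H →ₗ[ℝ] H))ᗮ) {C : ℝ} (hC0 : 0 ≤ C)
    (hC : ∀ z, ⟪k, S z⟫ ≤ C * ‖S z‖) :
    ‖k‖ ≤ C := by
  have h1 : k ∈ closure (range S) := by
    have h2 := S.orthogonal_ker
    rw [hS.adjoint_eq] at h2
    rw [h2] at hk
    exact hk
  have hcl : IsClosed {w : H | ⟪k, w⟫ ≤ C * ‖w‖} := isClosed_le (by fun_prop) (by fun_prop)
  have h3 : ⟪k, k⟫ ≤ C * ‖k‖ :=
    closure_minimal (by rintro _ ⟨z, rfl⟩; exact hC z) hcl h1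
  rw [real_inner_self_eq_norm_sq] at h3
  rcases eq_or_ne k 0 with rfl | hk0
  · simpa using hC0
  · have := norm_pos_iff.2 hk0
    nlinarith

theorem UniquenessHyp.Gam_spec (h : UniquenessHyp T A V G) {t : ℝ} (ht : 0 < t) (x : H) :
    Gam T G t x ∈ (LinearMap.ker (posSqrt (covOp T G t) : H →ₗ[ℝ] H))ᗮ ∧
      posSqrt (covOp T G t) (Gam T G t x) = T t x :=
  pseudoInv_spec (h.range_subset t ht ⟨x, rfl⟩)

theorem UniquenessHyp.Gam_smul (h : UniquenessHyp T A V G) {t : ℝ} (ht : 0 < t) (c : ℝ) (x : H) :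
    Gam T G t (c • x) = c • Gam T G t x := by
  rw [Gam, map_smul, pseudoInv_smul (h.range_subset t ht ⟨x, rfl⟩), Gam]

theorem StandardHyp.norm_posSqrt_sq (h : StandardHyp T A G) {t : ℝ} (ht : 0 ≤ t) (z : H) :
    ‖posSqrt (covOp T G t) z‖ ^ 2 = ∫ s in (0 : ℝ)..t, ⟪covIntegrand T G s z, z⟫ := by
  obtain ⟨h1, h2⟩ := posSqrt_spec_of_isPositive (h.isPositive_covOp ht)
  rw [← h.inner_covOp ht]
  conv_rhs => rw [← h2]
  rw [ContinuousLinearMap.comp_apply, h1.inner_left_eq_inner_right, real_inner_self_eq_norm_sq]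

/-- `Q_{s + t} ≥ e^{sA} Q_t e^{sA^*}`, in terms of square roots. -/
theorem StandardHyp.norm_posSqrt_adjoint_le (h : StandardHyp T A G) {s t : ℝ} (hs : 0 ≤ s)
    (ht : 0 ≤ t) (z : H) :
    ‖posSqrt (covOp T G t) (ContinuousLinearMap.adjoint (T s) z)‖
      ≤ ‖posSqrt (covOp T G (s + t)) z‖ := by
  refine abs_le_of_sq_le_sq' ?_ (norm_nonneg _) |>.2
  rw [h.norm_posSqrt_sq ht, h.norm_posSqrt_sq (by positivity)]
  have h1 : ∀ r ∈ uIcc 0 t, ⟪covIntegrand T G r (ContinuousLinearMap.adjoint (T s) z),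
      ContinuousLinearMap.adjoint (T s) z⟫ = ⟪covIntegrand T G (s + r) z, z⟫ := by
    intro r hr
    rw [uIcc_of_le ht] at hr
    rw [inner_covIntegrand, inner_covIntegrand, h.semigroup.map_add s r hs hr.1,
      ContinuousLinearMap.adjoint_comp, ContinuousLinearMap.comp_apply]
  rw [intervalIntegral.integral_congr h1,
    intervalIntegral.integral_comp_add_left (fun r => ⟪covIntegrand T G r z, z⟫) s, add_zero]
  have hi := h.intervalIntegrable_inner (by positivity : 0 ≤ s + t) z z
  refine intervalIntegral.integral_mono_interval hs (by linarith) le_rfl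
    (Eventually.of_forall fun r => ?_) hi
  simp only [Pi.zero_apply]
  rw [inner_covIntegrand]
  exact real_inner_self_nonneg

/-- `‖Γ_t x‖` is nonincreasing in `t`: the energy needed to steer `x` to `0` decreases as more time
is allowed. -/
theorem UniquenessHyp.norm_Gam_antitone (h : UniquenessHyp T A V G) {t t' : ℝ} (ht : 0 < t)
    (htt' : t ≤ t') (x : H) : ‖Gam T G t' x‖ ≤ ‖Gam T G t x‖ := by
  obtain ⟨s, hs, rfl⟩ : ∃ s, 0 ≤ s ∧ t' = s + t := ⟨t' - t, by linarith, by ring⟩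
  have ht' : 0 < s + t := by positivity
  obtain ⟨h1, h2⟩ := h.Gam_spec ht' x
  obtain ⟨-, h4⟩ := h.Gam_spec ht x
  have hp' := (posSqrt_spec_of_isPositive (h.isPositive_covOp ht'.le)).1
  have hp := (posSqrt_spec_of_isPositive (h.isPositive_covOp ht.le)).1
  refine norm_le_of_inner_le hp'.isSelfAdjoint h1 (norm_nonneg _) fun z => ?_
  rw [← hp'.inner_left_eq_inner_right, h2, h.semigroup.map_add s t hs ht.le,
    ContinuousLinearMap.comp_apply, ← h4, ← ContinuousLinearMap.adjoint_inner_right,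
    hp.inner_left_eq_inner_right]
  exact (real_inner_le_norm _ _).trans (mul_le_mul_of_nonneg_left
    (h.norm_posSqrt_adjoint_le hs ht.le z) (norm_nonneg _))

theorem UniquenessHyp.normGamV_antitoneOn (h : UniquenessHyp T A V G) :
    AntitoneOn (normGamV T G V) (Ioi 0) := fun t ht t' _ htt' =>
  iSup₂_mono fun v _ => by
    rw [← ofReal_norm, ← ofReal_norm]
    exact ENNReal.ofReal_le_ofReal (h.norm_Gam_antitone ht htt' (V v))

theorem UniquenessHyp.normGamV_lt_top (h : UniquenessHyp T A V G) {t : ℝ} (ht : 0 < t) :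
    normGamV T G V t < ∞ := by
  by_contra hcon
  rw [not_lt, top_le_iff] at hcon
  have h1 : ∫⁻ _ in Ioc 0 t, (∞ : ℝ≥0∞) ≤ ∫⁻ s in Ioc 0 t, normGamV T G V s :=
    setLIntegral_mono_ae' measurableSet_Ioc (Eventually.of_forall fun s hs =>
      hcon ▸ h.normGamV_antitoneOn hs.1 ht hs.2)
  have h2 := h1.trans_lt (h.gam_integrable t ht)
  rw [setLIntegral_const, Real.volume_Ioc, sub_zero,
    ENNReal.top_mul (ENNReal.ofReal_pos.2 ht).ne'] at h2
  exact lt_irrefl _ h2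

/-- The operator norm `‖Γ_t V‖` as a real number. -/
noncomputable def gamBound (T : ℝ → H →L[ℝ] H) (V G : U →L[ℝ] H) (t : ℝ) : ℝ :=
  (normGamV T G V t).toReal

theorem gamBound_nonneg (T : ℝ → H →L[ℝ] H) (V G : U →L[ℝ] H) (t : ℝ) : 0 ≤ gamBound T V G t :=
  ENNReal.toReal_nonneg

theorem UniquenessHyp.norm_Gam_le (h : UniquenessHyp T A V G) {t : ℝ} (ht : 0 < t) (v : U) :
    ‖Gam T G t (V v)‖ ≤ gamBound T V G t * ‖v‖ := by
  rcases eq_or_ne v 0 with rfl | hv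
  · have := h.Gam_smul ht 0 0
    rw [zero_smul, zero_smul] at this
    simp [this]
  have hv0 := norm_pos_iff.2 hv
  have h1 : ‖Gam T G t (V (‖v‖⁻¹ • v))‖ ≤ gamBound T V G t := by
    rw [gamBound, ← toReal_enorm]
    refine ENNReal.toReal_mono (h.normGamV_lt_top ht).ne ?_
    refine le_iSup₂_of_le (‖v‖⁻¹ • v) ?_ le_rfl
    rw [mem_closedBall_zero_iff, norm_smul, norm_inv, norm_norm, inv_mul_cancel₀ hv0.ne']
  rw [map_smul, h.Gam_smul ht, norm_smul, norm_inv, norm_norm, inv_mul_le_iff₀ hv0] at h1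
  linarith

theorem UniquenessHyp.gamBound_antitoneOn (h : UniquenessHyp T A V G) :
    AntitoneOn (gamBound T V G) (Ioi 0) := fun _ ht _ ht' htt' =>
  ENNReal.toReal_mono (h.normGamV_lt_top ht).ne (h.normGamV_antitoneOn ht ht' htt')

theorem UniquenessHyp.integrableOn_exp_mul_gamBound (h : UniquenessHyp T A V G) {lam : ℝ}
    (hlam : 0 < lam) :
    IntegrableOn (fun t => Real.exp (-lam * t) * gamBound T V G t) (Ioi 0) := by
  have hm : AEStronglyMeasurable (gamBound T V G) (volume.restrict (Ioi 0)) :=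
    (aemeasurable_restrict_of_antitoneOn measurableSet_Ioi
      h.gamBound_antitoneOn).aestronglyMeasurable
  have he : ∀ μ : Measure ℝ, AEStronglyMeasurable (fun t => Real.exp (-lam * t)) μ := fun μ =>
    Continuous.aestronglyMeasurable (by fun_prop)
  rw [← Ioc_union_Ioi_eq_Ioi zero_le_one]
  refine IntegrableOn.union ?_ ?_
  · have h1 : IntegrableOn (gamBound T V G) (Ioc 0 1) := by
      refine ⟨hm.mono_measure (Measure.restrict_mono Ioc_subset_Ioi_self le_rfl), ?_⟩
      refine lt_of_le_of_lt (setLIntegral_mono_ae' measurableSet_Ioc (Eventually.of_forall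
        fun s hs => ?_)) (h.gam_integrable 1 one_pos)
      rw [← ofReal_norm, Real.norm_of_nonneg (gamBound_nonneg T V G s), gamBound,
        ENNReal.ofReal_toReal (h.normGamV_lt_top hs.1).ne]
    refine Integrable.bdd_mul (c := 1) h1 (he _)
      ((ae_restrict_iff' measurableSet_Ioc).2 (Eventually.of_forall fun s hs => ?_))
    rw [Real.norm_eq_abs, Real.abs_exp, Real.exp_le_one_iff]
    nlinarith [hs.1]
  · have h1 : IntegrableOn (fun t => Real.exp (-lam * t)) (Ioi 1) := exp_neg_integrableOn_Ioi 1 hlam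
    refine Integrable.mul_bdd (c := gamBound T V G 1) h1
      (hm.mono_measure (Measure.restrict_mono (Ioi_subset_Ioi zero_le_one) le_rfl))
      ((ae_restrict_iff' measurableSet_Ioi).2 (Eventually.of_forall fun s hs => ?_))
    have hs : 1 < s := hs
    rw [Real.norm_of_nonneg (gamBound_nonneg T V G s)]
    exact h.gamBound_antitoneOn (mem_Ioi.2 one_pos) (mem_Ioi.2 (one_pos.trans hs)) hs.le

theorem UniquenessHyp.tendsto_integral_exp_mul_gamBound (h : UniquenessHyp T A V G) :
    Tendsto (fun lam : ℝ => ∫ t in Ioi (0 : ℝ), Real.exp (-lam * t) * gamBound T V G t) atTop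
      (𝓝 0) := by
  have h1 := tendsto_integral_filter_of_dominated_convergence
    (μ := volume.restrict (Ioi (0 : ℝ))) (l := atTop)
    (F := fun (lam : ℝ) t => Real.exp (-lam * t) * gamBound T V G t) (f := fun _ => 0)
    (fun t => Real.exp (-1 * t) * gamBound T V G t) ?_ ?_
    (h.integrableOn_exp_mul_gamBound one_pos) ?_
  · simpa using h1
  · filter_upwards [eventually_gt_atTop 0] with lam hlam
    exact (h.integrableOn_exp_mul_gamBound hlam).aestronglyMeasurable
  · filter_upwards [eventually_ge_atTop 1] with lam hlam
    refine (ae_restrict_iff' measurableSet_Ioi).2 (Eventually.of_forall fun s hs => ?_)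
    have hs : 0 < s := hs
    rw [norm_mul, Real.norm_of_nonneg (gamBound_nonneg T V G s), Real.norm_eq_abs, Real.abs_exp]
    refine mul_le_mul_of_nonneg_right (Real.exp_le_exp.2 ?_) (gamBound_nonneg T V G s)
    nlinarith
  · refine (ae_restrict_iff' measurableSet_Ioi).2 (Eventually.of_forall fun s hs => ?_)
    have hs : 0 < s := hs
    rw [← zero_mul (gamBound T V G s)]
    refine Tendsto.mul_const _ (Real.tendsto_exp_atBot.comp ?_)
    exact (tendsto_neg_atTop_atBot.atBot_mul_const hs)

end Gamma

/-! ### From directional derivatives to the gradient -/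

section Gradient

variable {H U : Type*} [NormedAddCommGroup H] [InnerProductSpace ℝ H]
  [NormedAddCommGroup U] [InnerProductSpace ℝ U] {V : U →L[ℝ] H} {f : H → ℝ} {D : U → H → ℝ}

theorem hasDerivAt_along (hD : ∀ v x, HasDerivAt (fun s : ℝ => f (x + s • V v)) (D v x) 0)
    (v : U) (x : H) (s : ℝ) :
    HasDerivAt (fun s : ℝ => f (x + s • V v)) (D v (x + s • V v)) s := by
  have h1 := hD v (x + s • V v)
  have h2 : HasDerivAt (fun r : ℝ => r - s) 1 s := (hasDerivAt_id s).sub_const s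
  have h3 := HasDerivAt.comp_of_eq s h1 h2 (sub_self s).symm
  rw [mul_one] at h3
  refine h3.congr_of_eventuallyEq (Eventually.of_forall fun r => ?_)
  simp only [Function.comp]
  rw [add_assoc, ← add_smul, add_sub_cancel]

/-- The mean value inequality along a direction. -/
theorem abs_sub_le_of_hasDerivAt
    (hD : ∀ v x, HasDerivAt (fun s : ℝ => f (x + s • V v)) (D v x) 0)
    {v : U} {C : ℝ} (hC : ∀ x, |D v x| ≤ C) (x : H) (s r : ℝ) :
    |f (x + s • V v) - f (x + r • V v)| ≤ C * |s - r| := by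
  have := convex_univ.norm_image_sub_le_of_norm_hasDerivWithin_le
    (f := fun s : ℝ => f (x + s • V v)) (f' := fun s => D v (x + s • V v)) (C := C)
    (fun s _ => (hasDerivAt_along hD v x s).hasDerivWithinAt) (fun s _ => hC _)
    (mem_univ r) (mem_univ s)
  simpa using this

/-- Continuous directional derivatives are additive in the direction. -/
theorem dirDeriv_add (hD : ∀ v x, HasDerivAt (fun s : ℝ => f (x + s • V v)) (D v x) 0)
    (hc : ∀ v, Continuous (D v)) (v w : U) (x : H) : D (v + w) x = D v x + D w x := by
  refine (hD (v + w) x).unique ?_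
  -- split the increment along `v + w` into an increment along `v` and one along `w`
  have h1 : HasDerivAt (fun s : ℝ => f (x + s • V v + s • V w) - f (x + s • V v)) (D w x) 0 := by
    rw [hasDerivAt_iff_isLittleO, Asymptotics.isLittleO_iff]
    intro ε hε
    obtain ⟨δ, hδ, hδ'⟩ := Metric.continuousAt_iff.1 ((hc w).continuousAt (x := x)) ε hε
    have hcont : Continuous fun p : ℝ => |p| * (‖V v‖ + ‖V w‖) := by fun_prop
    have hev : ∀ᶠ s : ℝ in 𝓝 0, |s| * (‖V v‖ + ‖V w‖) < δ :=
      hcont.tendsto 0 |>.eventually_lt_const (by simpa using hδ)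
    filter_upwards [hev] with s hs
    have h2 := (convex_uIcc (0 : ℝ) s).norm_image_sub_le_of_norm_hasDerivWithin_le
      (f := fun r : ℝ => f (x + s • V v + r • V w) - r * D w x)
      (f' := fun r => D w (x + s • V v + r • V w) - D w x) (C := ε)
      (fun r _ => ((hasDerivAt_along hD w (x + s • V v) r).sub
        (by simpa using (hasDerivAt_id r).mul_const (D w x))).hasDerivWithinAt)
      (fun r hr => ?_) left_mem_uIcc right_mem_uIcc
    · simp only [zero_smul, add_zero, zero_mul, sub_zero, smul_eq_mul, sub_self] at h2 ⊢
      convert h2 using 2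
      ring
    · have hr' : |r| ≤ |s| := by
        have := abs_sub_left_of_mem_uIcc hr
        simpa using this
      rw [← dist_eq_norm]
      refine (hδ' ?_).le
      rw [dist_eq_norm, add_assoc, add_sub_cancel_left]
      refine (norm_add_le _ _).trans_lt (lt_of_le_of_lt ?_ hs)
      rw [norm_smul, norm_smul, mul_add, Real.norm_eq_abs, Real.norm_eq_abs]
      gcongr
  have h3 := h1.add (hD v x)
  rw [add_comm (D v x)]
  refine h3.congr_of_eventuallyEq (Eventually.of_forall fun s => ?_)
  simp only [Pi.add_apply, map_add, smul_add, ← add_assoc]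
  ring

theorem dirDeriv_smul (hD : ∀ v x, HasDerivAt (fun s : ℝ => f (x + s • V v)) (D v x) 0)
    (c : ℝ) (v : U) (x : H) : D (c • v) x = c * D v x := by
  refine (hD (c • v) x).unique ?_
  have h2 : HasDerivAt (fun r : ℝ => r * c) c 0 := by
    simpa using (hasDerivAt_id (0 : ℝ)).mul_const c
  have h3 := HasDerivAt.comp_of_eq 0 (hD v x) h2 (zero_mul c).symm
  rw [mul_comm]
  refine h3.congr_of_eventuallyEq (Eventually.of_forall fun r => ?_)
  simp [smul_smul]

theorem hasVGradAt_of_inner_eq {x : H} {ℓ : U}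
    (hD : ∀ v, HasDerivAt (fun s : ℝ => f (x + s • V v)) ⟪ℓ, v⟫ 0) : HasVGradAt V f ℓ x := by
  intro v
  have h1 := (hD v).tendsto_slope_zero
  simp only [zero_add, zero_smul, add_zero, smul_eq_mul] at h1
  have h2 := (h1.sub_const ⟪ℓ, v⟫).abs
  simp only [sub_self, abs_zero] at h2
  refine h2.congr fun s => ?_
  rw [inv_mul_eq_div]

theorem HasVGradAt.add {f₁ f₂ : H → ℝ} {ℓ₁ ℓ₂ : U} {x : H} (h₁ : HasVGradAt V f₁ ℓ₁ x)
    (h₂ : HasVGradAt V f₂ ℓ₂ x) : HasVGradAt V (fun x => f₁ x + f₂ x) (ℓ₁ + ℓ₂) x := by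
  intro v
  have a := (tendsto_zero_iff_abs_tendsto_zero _).2 (h₁ v)
  have b := (tendsto_zero_iff_abs_tendsto_zero _).2 (h₂ v)
  refine (tendsto_zero_iff_abs_tendsto_zero _).1 ?_
  have c := a.add b
  rw [add_zero] at c
  refine c.congr fun s => ?_
  rw [inner_add_left]
  ring

theorem norm_le_of_forall_inner_le {ℓ : U} {C : ℝ} (hC : 0 ≤ C)
    (h : ∀ v : U, ‖v‖ ≤ 1 → ⟪ℓ, v⟫ ≤ C) : ‖ℓ‖ ≤ C := by
  rcases eq_or_ne ℓ 0 with rfl | hℓ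
  · simpa using hC
  have hℓ0 := norm_pos_iff.2 hℓ
  have h1 := h (‖ℓ‖⁻¹ • ℓ) (by rw [norm_smul, norm_inv, norm_norm, inv_mul_cancel₀ hℓ0.ne'])
  rwa [real_inner_smul_right, real_inner_self_eq_norm_sq, pow_two, ← mul_assoc,
    inv_mul_cancel₀ hℓ0.ne', one_mul] at h1

variable [CompleteSpace U]

/-- If all directional derivatives along `V v` exist, are continuous, and are bounded by `C ‖v‖`,
then `f` has a `V`-gradient everywhere, by the Riesz representation theorem. -/
theorem vGrad_of_dirDeriv (hD : ∀ v x, HasDerivAt (fun s : ℝ => f (x + s • V v)) (D v x) 0)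
    (hc : ∀ v, Continuous (D v)) {C : ℝ} (hC : ∀ v x, |D v x| ≤ C * ‖v‖) (x : H) :
    HasVGradAt V f (vGrad V f x) x ∧ (∀ v, ⟪vGrad V f x, v⟫ = D v x) := by
  let L : StrongDual ℝ U := LinearMap.mkContinuous
    { toFun := fun v => D v x
      map_add' := fun v w => dirDeriv_add hD hc v w x
      map_smul' := fun c v => dirDeriv_smul hD c v x } C (fun v => hC v x)
  have h1 : ∀ v, ⟪(InnerProductSpace.toDual ℝ U).symm L, v⟫ = D v x := fun v => by
    rw [InnerProductSpace.toDual_symm_apply]; rfl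
  have h2 : HasVGradAt V f ((InnerProductSpace.toDual ℝ U).symm L) x :=
    hasVGradAt_of_inner_eq fun v => by rw [h1]; exact hD v x
  rw [h2.vGrad_eq]
  exact ⟨h2, h1⟩

end Gradient

/-! ### Smoothing by the Ornstein-Uhlenbeck semigroup -/

section Smoothing

variable {H U : Type*} [NormedAddCommGroup H] [InnerProductSpace ℝ H] [CompleteSpace H]
  [NormedAddCommGroup U] [InnerProductSpace ℝ U] [CompleteSpace U]
  [MeasurableSpace H] [BorelSpace H]
  {T : ℝ → H →L[ℝ] H} {A : H →ₗ.[ℝ] H} {V G : U →L[ℝ] H}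

theorem ouSemigroup_add_smul {t : ℝ} (ψ : H → ℝ) (v : U) (x : H) (s : ℝ) :
    ouSemigroup T G t ψ (x + s • V v)
      = ∫ y, ψ (T t x + (y + s • T t (V v))) ∂(gaussianMeasure (covOp T G t)) := by
  refine integral_congr_ae (Eventually.of_forall fun y => ?_)
  simp only [map_add, map_smul]
  congr 1
  abel

variable [TopologicalSpace.SeparableSpace H]

theorem StandardHyp.integrable_shift (h : StandardHyp T A G) {t : ℝ} (ht : 0 < t) {χ : H → ℝ}
    (hχ : Continuous χ) {M : ℝ} (hM : ∀ x, |χ x| ≤ M) (z : H) :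
    Integrable (fun y => χ (z + y)) (gaussianMeasure (covOp T G t)) := by
  have := h.isProbabilityMeasure ht
  have : SecondCountableTopology H := UniformSpace.secondCountable_of_separable H
  exact Integrable.of_bound (hχ.comp (by fun_prop)).aestronglyMeasurable M
    (Eventually.of_forall fun y => hM _)

theorem StandardHyp.abs_ouSemigroup_le (h : StandardHyp T A G) {t : ℝ} (ht : 0 < t) {χ : H → ℝ}
    {M : ℝ} {x : H} (hM : ∀ y, |χ (T t x + y)| ≤ M) : |ouSemigroup T G t χ x| ≤ M := by
  have := h.isProbabilityMeasure ht
  simpa [ouSemigroup] using norm_integral_le_of_norm_le_const (μ := gaussianMeasure (covOp T G t))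
    (f := fun y => χ (T t x + y)) (Eventually.of_forall fun y => hM y)

theorem StandardHyp.ouSemigroup_sub (h : StandardHyp T A G) {t : ℝ} (ht : 0 < t) {φ ψ : H → ℝ}
    (hφ : Continuous φ) {M : ℝ} (hM : ∀ x, |φ x| ≤ M) (hψ : Continuous ψ) {M' : ℝ}
    (hM' : ∀ x, |ψ x| ≤ M') (x : H) :
    ouSemigroup T G t (fun z => φ z - ψ z) x = ouSemigroup T G t φ x - ouSemigroup T G t ψ x :=
  integral_sub (h.integrable_shift ht hφ hM _) (h.integrable_shift ht hψ hM' _)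

theorem StandardHyp.uniformContinuous_ouSemigroup (h : StandardHyp T A G) {t : ℝ} (ht : 0 < t)
    {ψ : H → ℝ} (hψ : IsUCb ψ) : UniformContinuous (ouSemigroup T G t ψ) := by
  obtain ⟨hu, M, hM⟩ := hψ
  have hp := h.isProbabilityMeasure ht
  rw [Metric.uniformContinuous_iff]
  intro ε hε
  obtain ⟨δ, hδ, hδ'⟩ := Metric.uniformContinuous_iff.1 hu (ε / 2) (by positivity)
  obtain ⟨ρ, hρ, hρ'⟩ := Metric.uniformContinuous_iff.1 (T t).uniformContinuous δ hδ
  refine ⟨ρ, hρ, fun {x x'} hx => ?_⟩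
  rw [dist_eq_norm, ouSemigroup, ouSemigroup, ← integral_sub
    (h.integrable_shift ht hu.continuous hM _) (h.integrable_shift ht hu.continuous hM _)]
  refine lt_of_le_of_lt ?_ (half_lt_self hε)
  have := norm_integral_le_of_norm_le_const (μ := gaussianMeasure (covOp T G t)) (C := ε / 2)
    (f := fun y => ψ (T t x + y) - ψ (T t x' + y)) (Eventually.of_forall fun y => ?_)
  · simpa using this
  · rw [← dist_eq_norm]
    exact (hδ' (by rw [dist_add_right]; exact hρ' hx)).le

/-- The derivative of `R(t)ψ` at `x` in the direction `V v`. -/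
noncomputable def ouDeriv (T : ℝ → H →L[ℝ] H) (V G : U →L[ℝ] H) (t : ℝ) (ψ : H → ℝ) (v : U)
    (x : H) : ℝ :=
  deriv (fun s : ℝ => ouSemigroup T G t ψ (x + s • V v)) 0

/-- The direction `e^{tA} V v` equals `Q_t^{1/2} Γ_t V v`, so that it lies in the Cameron-Martin
space of `N(0, Q_t)`. -/
theorem UniquenessHyp.exists_hasDerivAt (h : UniquenessHyp T A V G) {t : ℝ} (ht : 0 < t)
    {χ : H → ℝ} (hχ : Continuous χ) {M : ℝ} (hM : ∀ x, |χ x| ≤ M) (v : U) :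
    ∃ d : ℝ, HasDerivAt
      (fun s : ℝ => ∫ y, χ (y + s • T t (V v)) ∂(gaussianMeasure (covOp T G t))) d 0 ∧
      |d| ≤ gamBound T V G t * ‖v‖ * M := by
  have hM0 : 0 ≤ M := (abs_nonneg _).trans (hM 0)
  obtain ⟨w, b, hb⟩ := h.toStandardHyp.exists_hilbertBasis_summable
  have := countable_of_hilbertBasis b
  have : SecondCountableTopology H := UniformSpace.secondCountable_of_separable H
  obtain ⟨h1, h2⟩ := posSqrt_spec_of_isPositive (h.isPositive_covOp ht.le)
  obtain ⟨hp, hG, -⟩ := gaussianMeasure_spec b h1 h2 (hb t ht _ h1 h2)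
  obtain ⟨d, hd, hd'⟩ := hG.hasDerivAt_integral b (hb t ht _ h1 h2) (Gam T G t (V v)) hχ hM
  rw [(h.Gam_spec ht (V v)).2] at hd
  exact ⟨d, hd, hd'.trans (mul_le_mul_of_nonneg_right (h.norm_Gam_le ht v) hM0)⟩

theorem UniquenessHyp.hasDerivAt_ouSemigroup (h : UniquenessHyp T A V G) {t : ℝ} (ht : 0 < t)
    {ψ : H → ℝ} (hψ : Continuous ψ) {M : ℝ} (hM : ∀ x, |ψ x| ≤ M) (v : U) (x : H) :
    HasDerivAt (fun s : ℝ => ouSemigroup T G t ψ (x + s • V v)) (ouDeriv T V G t ψ v x) 0 := by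
  obtain ⟨d, hd, -⟩ := h.exists_hasDerivAt ht (χ := fun y => ψ (T t x + y))
    (hψ.comp (by fun_prop)) (fun y => hM _) v
  have : HasDerivAt (fun s : ℝ => ouSemigroup T G t ψ (x + s • V v)) d 0 :=
    hd.congr_of_eventuallyEq (Eventually.of_forall fun s => ouSemigroup_add_smul ψ v x s)
  exact this.differentiableAt.hasDerivAt

theorem UniquenessHyp.abs_ouDeriv_le (h : UniquenessHyp T A V G) {t : ℝ} (ht : 0 < t)
    {ψ : H → ℝ} (hψ : Continuous ψ) {M : ℝ} (hM : ∀ x, |ψ x| ≤ M) (v : U) (x : H) :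
    |ouDeriv T V G t ψ v x| ≤ gamBound T V G t * ‖v‖ * M := by
  obtain ⟨d, hd, hd'⟩ := h.exists_hasDerivAt ht (χ := fun y => ψ (T t x + y))
    (hψ.comp (by fun_prop)) (fun y => hM _) v
  have : HasDerivAt (fun s : ℝ => ouSemigroup T G t ψ (x + s • V v)) d 0 :=
    hd.congr_of_eventuallyEq (Eventually.of_forall fun s => ouSemigroup_add_smul ψ v x s)
  rwa [ouDeriv, this.deriv]

/-- The derivative at `x` depends only on, and linearly on, the function `ψ(e^{tA}x + ·)`; hence it
inherits the modulus of continuity of `ψ`. -/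
theorem UniquenessHyp.abs_ouDeriv_sub_le (h : UniquenessHyp T A V G) {t : ℝ} (ht : 0 < t)
    {ψ : H → ℝ} (hψ : Continuous ψ) {M : ℝ} (hM : ∀ x, |ψ x| ≤ M) (v : U) {x x' : H} {δ : ℝ}
    (hδ : ∀ y, |ψ (T t x + y) - ψ (T t x' + y)| ≤ δ) :
    |ouDeriv T V G t ψ v x - ouDeriv T V G t ψ v x'| ≤ gamBound T V G t * ‖v‖ * δ := by
  obtain ⟨d, hd, hd'⟩ := h.exists_hasDerivAt ht
    (χ := fun y => ψ (T t x + y) - ψ (T t x' + y))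
    ((hψ.comp (by fun_prop)).sub (hψ.comp (by fun_prop))) hδ v
  have h1 := (h.hasDerivAt_ouSemigroup ht hψ hM v x).sub (h.hasDerivAt_ouSemigroup ht hψ hM v x')
  rwa [h1.unique (hd.congr_of_eventuallyEq (Eventually.of_forall fun s => ?_))]
  simp only [Pi.sub_apply]
  rw [ouSemigroup, ouSemigroup, ← integral_sub (h.integrable_shift ht hψ hM _)
    (h.integrable_shift ht hψ hM _)]
  refine integral_congr_ae (Eventually.of_forall fun y => ?_)
  simp only [map_add, map_smul]
  congr 2 <;> abel

/-- Uniform continuity in `x` of the directional derivatives of `R(t)ψ`, uniformly over directions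
in the unit ball. -/
theorem UniquenessHyp.tendsto_ouDeriv_sub (h : UniquenessHyp T A V G) {t : ℝ} (ht : 0 < t)
    {ψ : H → ℝ} (hψ : IsUCb ψ) :
    Tendsto (fun q : (H × H) × U => ouDeriv T V G t ψ q.2 q.1.1 - ouDeriv T V G t ψ q.2 q.1.2)
      (uniformity H ×ˢ 𝓟 (Metric.closedBall 0 1)) (𝓝 0) := by
  obtain ⟨hu, M, hM⟩ := hψ
  rw [Metric.tendsto_nhds]
  intro ε hε
  have hN := gamBound_nonneg T V G t
  set ε' := ε / (gamBound T V G t + 1) with hε'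
  have hε0 : 0 < ε' := by positivity
  obtain ⟨δ, hδ, hδ'⟩ := Metric.uniformContinuous_iff.1 hu ε' hε0
  obtain ⟨ρ, hρ, hρ'⟩ := Metric.uniformContinuous_iff.1 (T t).uniformContinuous δ hδ
  rw [eventually_prod_principal_iff]
  filter_upwards [Metric.dist_mem_uniformity hρ] with p hp v hv
  rw [mem_closedBall_zero_iff] at hv
  have h1 := h.abs_ouDeriv_sub_le ht hu.continuous hM v (x := p.1) (x' := p.2) (δ := ε')
    (fun y => by
      rw [← Real.dist_eq]
      exact (hδ' (by rw [dist_add_right]; exact hρ' hp)).le)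
  rw [dist_zero_right, Real.norm_eq_abs]
  refine h1.trans_lt ?_
  calc gamBound T V G t * ‖v‖ * ε' ≤ gamBound T V G t * 1 * ε' := by gcongr
    _ < (gamBound T V G t + 1) * ε' := by nlinarith
    _ = ε := by rw [hε']; field_simp

end Smoothing

/-! ### The resolvent of the Ornstein-Uhlenbeck semigroup -/

section Resolvent

variable {H U : Type*} [NormedAddCommGroup H] [InnerProductSpace ℝ H] [CompleteSpace H]
  [NormedAddCommGroup U] [InnerProductSpace ℝ U] [CompleteSpace U]
  {T : ℝ → H →L[ℝ] H} {A : H →ₗ.[ℝ] H} {V G : U →L[ℝ] H}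

/-- The Laplace transform of `t ↦ ‖Γ_t V‖`. -/
noncomputable def gamLaplace (T : ℝ → H →L[ℝ] H) (V G : U →L[ℝ] H) (lam : ℝ) : ℝ :=
  ∫ t in Ioi (0 : ℝ), Real.exp (-lam * t) * gamBound T V G t

theorem gamLaplace_nonneg (T : ℝ → H →L[ℝ] H) (V G : U →L[ℝ] H) (lam : ℝ) :
    0 ≤ gamLaplace T V G lam :=
  integral_nonneg fun t => mul_nonneg (Real.exp_pos _).le (gamBound_nonneg T V G t)

theorem ae_restrict_Ioi {p : ℝ → Prop} (h : ∀ t : ℝ, 0 < t → p t) :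
    ∀ᵐ t ∂(volume.restrict (Ioi (0 : ℝ))), p t :=
  (ae_restrict_iff' measurableSet_Ioi).2 (Eventually.of_forall fun t ht => h t ht)

theorem integrableOn_exp_neg_mul {lam : ℝ} (hlam : 0 < lam) :
    IntegrableOn (fun t => Real.exp (-lam * t)) (Ioi (0 : ℝ)) :=
  exp_neg_integrableOn_Ioi 0 hlam

theorem integral_exp_neg_mul {lam : ℝ} (hlam : 0 < lam) :
    ∫ t in Ioi (0 : ℝ), Real.exp (-lam * t) = lam⁻¹ := by
  rw [integral_exp_mul_Ioi (by linarith) 0]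
  simp

variable [MeasurableSpace H] [BorelSpace H]

/-- The resolvent `∫₀^∞ e^{-lam t} R(t)ψ dt` of the Ornstein-Uhlenbeck semigroup. -/
noncomputable def ouResolvent (T : ℝ → H →L[ℝ] H) (G : U →L[ℝ] H) (lam : ℝ) (ψ : H → ℝ) (x : H) :
    ℝ :=
  ∫ t in Ioi (0 : ℝ), Real.exp (-lam * t) * ouSemigroup T G t ψ x

/-- The derivative of `ouResolvent T G lam ψ` at `x` in the direction `V v`. -/
noncomputable def resolventDeriv (T : ℝ → H →L[ℝ] H) (V G : U →L[ℝ] H) (lam : ℝ) (ψ : H → ℝ)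
    (v : U) (x : H) : ℝ :=
  ∫ t in Ioi (0 : ℝ), Real.exp (-lam * t) * ouDeriv T V G t ψ v x

variable [TopologicalSpace.SeparableSpace H]

theorem StandardHyp.aestronglyMeasurable_exp_mul (h : StandardHyp T A G) (lam : ℝ) {ψ : H → ℝ}
    (hψ : Continuous ψ) {M : ℝ} (hM : ∀ x, |ψ x| ≤ M) (x : H) :
    AEStronglyMeasurable (fun t => Real.exp (-lam * t) * ouSemigroup T G t ψ x)
      (volume.restrict (Ioi 0)) :=
  (Continuous.aestronglyMeasurable (by fun_prop)).mul (h.aestronglyMeasurable_ouSemigroup hψ hM x)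

theorem StandardHyp.integrableOn_exp_mul_ouSemigroup (h : StandardHyp T A G) {lam : ℝ}
    (hlam : 0 < lam) {ψ : H → ℝ} (hψ : Continuous ψ) {M : ℝ} (hM : ∀ x, |ψ x| ≤ M) (x : H) :
    IntegrableOn (fun t => Real.exp (-lam * t) * ouSemigroup T G t ψ x) (Ioi 0) := by
  refine Integrable.mono' ((integrableOn_exp_neg_mul hlam).mul_const M)
    (h.aestronglyMeasurable_exp_mul lam hψ hM x) (ae_restrict_Ioi fun t ht => ?_)
  rw [norm_mul, Real.norm_eq_abs, Real.abs_exp]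
  exact mul_le_mul_of_nonneg_left (h.abs_ouSemigroup_le ht fun y => hM _) (Real.exp_pos _).le

theorem StandardHyp.abs_resolvent_le (h : StandardHyp T A G) {lam : ℝ}
    (hlam : 0 < lam) {ψ : H → ℝ} {M : ℝ} (hM : ∀ x, |ψ x| ≤ M) (x : H) :
    |ouResolvent T G lam ψ x| ≤ lam⁻¹ * M := by
  rw [← integral_exp_neg_mul hlam, ← integral_mul_const, ← Real.norm_eq_abs, ouResolvent]
  refine norm_integral_le_of_norm_le ((integrableOn_exp_neg_mul hlam).mul_const M)
    (ae_restrict_Ioi fun t ht => ?_)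
  rw [norm_mul, Real.norm_eq_abs, Real.abs_exp]
  exact mul_le_mul_of_nonneg_left (h.abs_ouSemigroup_le ht fun y => hM _) (Real.exp_pos _).le

theorem StandardHyp.resolvent_sub (h : StandardHyp T A G) {lam : ℝ} (hlam : 0 < lam)
    {φ ψ : H → ℝ} (hφ : IsUCb φ) (hψ : IsUCb ψ) (x : H) :
    ouResolvent T G lam (fun z => φ z - ψ z) x
      = ouResolvent T G lam φ x - ouResolvent T G lam ψ x := by
  obtain ⟨hφ, M, hM⟩ := hφ
  obtain ⟨hψ, M', hM'⟩ := hψ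
  rw [ouResolvent, ouResolvent, ouResolvent, ← integral_sub
    (h.integrableOn_exp_mul_ouSemigroup hlam hφ.continuous hM x)
    (h.integrableOn_exp_mul_ouSemigroup hlam hψ.continuous hM' x)]
  refine integral_congr_ae (ae_restrict_Ioi fun t ht => ?_)
  simp only
  rw [h.ouSemigroup_sub ht hφ.continuous hM hψ.continuous hM', mul_sub]

theorem StandardHyp.isUCb_resolvent (h : StandardHyp T A G) {lam : ℝ} (hlam : 0 < lam)
    {ψ : H → ℝ} (hψ : IsUCb ψ) : IsUCb (ouResolvent T G lam ψ) := by
  obtain ⟨hu, M, hM⟩ := id hψ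
  refine ⟨?_, lam⁻¹ * M, h.abs_resolvent_le hlam hM⟩
  have hint := fun x => h.integrableOn_exp_mul_ouSemigroup hlam hu.continuous hM x
  -- dominated convergence along the uniformity of `H`
  have key := tendsto_integral_filter_of_dominated_convergence
    (μ := volume.restrict (Ioi (0 : ℝ))) (l := uniformity H)
    (F := fun p t => Real.exp (-lam * t) * ouSemigroup T G t ψ p.1 -
      Real.exp (-lam * t) * ouSemigroup T G t ψ p.2) (f := fun _ => 0)
    (fun t => Real.exp (-lam * t) * (2 * M))
    (Eventually.of_forall fun p => ((hint p.1).sub (hint p.2)).aestronglyMeasurable)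
    (Eventually.of_forall fun p => ae_restrict_Ioi fun t ht => ?_)
    ((integrableOn_exp_neg_mul hlam).mul_const _)
    (ae_restrict_Ioi fun t ht => ?_)
  · rw [Metric.uniformContinuous_iff]
    intro ε hε
    rw [integral_zero] at key
    obtain ⟨δ, hδ, hδ'⟩ := Metric.mem_uniformity_dist.1 (Metric.tendsto_nhds.1 key ε hε)
    refine ⟨δ, hδ, fun {a b} hab => ?_⟩
    have h1 := hδ' hab
    change dist (∫ t in Ioi (0 : ℝ), (_ - _)) 0 < ε at h1
    rwa [integral_sub (hint a) (hint b), dist_zero_right, ← dist_eq_norm] at h1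
  · rw [← mul_sub, norm_mul, Real.norm_eq_abs, Real.abs_exp]
    refine mul_le_mul_of_nonneg_left ?_ (Real.exp_pos _).le
    refine (norm_sub_le _ _).trans ?_
    rw [two_mul]
    exact add_le_add (h.abs_ouSemigroup_le ht fun y => hM _)
      (h.abs_ouSemigroup_le ht fun y => hM _)
  · have h1 := (h.uniformContinuous_ouSemigroup ht hψ)
    have h2 : Tendsto (fun p : H × H => ouSemigroup T G t ψ p.1 - ouSemigroup T G t ψ p.2)
        (uniformity H) (𝓝 0) := by
      rw [Metric.tendsto_nhds]
      intro ε hε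
      filter_upwards [h1 (Metric.dist_mem_uniformity hε)] with p hp
      rw [dist_zero_right, ← dist_eq_norm]
      exact hp
    simpa [mul_sub] using h2.const_mul (Real.exp (-lam * t))

theorem UniquenessHyp.aestronglyMeasurable_ouDeriv (h : UniquenessHyp T A V G) {ψ : H → ℝ}
    (hψ : Continuous ψ) {M : ℝ} (hM : ∀ x, |ψ x| ≤ M) (v : U) (x : H) :
    AEStronglyMeasurable (fun t => ouDeriv T V G t ψ v x) (volume.restrict (Ioi 0)) := by
  refine aestronglyMeasurable_of_tendsto_ae (𝓝[≠] (0 : ℝ))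
    (f := fun s t => s⁻¹ * (ouSemigroup T G t ψ (x + s • V v) - ouSemigroup T G t ψ x))
    (fun s => ((h.aestronglyMeasurable_ouSemigroup hψ hM _).sub
      (h.aestronglyMeasurable_ouSemigroup hψ hM _)).const_mul _)
    (ae_restrict_Ioi fun t ht => ?_)
  simpa using (h.hasDerivAt_ouSemigroup ht hψ hM v x).tendsto_slope_zero

theorem UniquenessHyp.norm_exp_mul_ouDeriv_le (h : UniquenessHyp T A V G) (lam : ℝ) {ψ : H → ℝ}
    (hψ : Continuous ψ) {M : ℝ} (hM : ∀ x, |ψ x| ≤ M) (v : U) (x : H) {t : ℝ} (ht : 0 < t) :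
    ‖Real.exp (-lam * t) * ouDeriv T V G t ψ v x‖
      ≤ Real.exp (-lam * t) * gamBound T V G t * (‖v‖ * M) := by
  rw [norm_mul, Real.norm_eq_abs, Real.abs_exp, mul_assoc, ← mul_assoc (gamBound T V G t)]
  exact mul_le_mul_of_nonneg_left (h.abs_ouDeriv_le ht hψ hM v x) (Real.exp_pos _).le

theorem UniquenessHyp.integrableOn_exp_mul_ouDeriv (h : UniquenessHyp T A V G) {lam : ℝ}
    (hlam : 0 < lam) {ψ : H → ℝ} (hψ : Continuous ψ) {M : ℝ} (hM : ∀ x, |ψ x| ≤ M) (v : U)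
    (x : H) : IntegrableOn (fun t => Real.exp (-lam * t) * ouDeriv T V G t ψ v x) (Ioi 0) :=
  Integrable.mono' ((h.integrableOn_exp_mul_gamBound hlam).mul_const _)
    ((Continuous.aestronglyMeasurable (by fun_prop)).mul
      (h.aestronglyMeasurable_ouDeriv hψ hM v x))
    (ae_restrict_Ioi fun _ ht => h.norm_exp_mul_ouDeriv_le lam hψ hM v x ht)

theorem UniquenessHyp.abs_resolventDeriv_le (h : UniquenessHyp T A V G) {lam : ℝ}
    (hlam : 0 < lam) {ψ : H → ℝ} (hψ : Continuous ψ) {M : ℝ} (hM : ∀ x, |ψ x| ≤ M) (v : U)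
    (x : H) : |resolventDeriv T V G lam ψ v x| ≤ gamLaplace T V G lam * M * ‖v‖ := by
  rw [mul_assoc, mul_comm M, gamLaplace, ← integral_mul_const]
  exact norm_integral_le_of_norm_le ((h.integrableOn_exp_mul_gamBound hlam).mul_const _)
    (ae_restrict_Ioi fun _ ht => h.norm_exp_mul_ouDeriv_le lam hψ hM v x ht)

theorem UniquenessHyp.hasDerivAt_resolvent (h : UniquenessHyp T A V G) {lam : ℝ}
    (hlam : 0 < lam) {ψ : H → ℝ} (hψ : Continuous ψ) {M : ℝ} (hM : ∀ x, |ψ x| ≤ M) (v : U)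
    (x : H) :
    HasDerivAt (fun s : ℝ => ouResolvent T G lam ψ (x + s • V v)) (resolventDeriv T V G lam ψ v x)
      0 := by
  have hM0 : 0 ≤ M := (abs_nonneg _).trans (hM 0)
  refine (hasDerivAt_integral_of_dominated_loc_of_lip (μ := volume.restrict (Ioi (0 : ℝ)))
    (F := fun (s : ℝ) t => Real.exp (-lam * t) * ouSemigroup T G t ψ (x + s • V v))
    (bound := fun t => Real.exp (-lam * t) * gamBound T V G t * (‖v‖ * M))
    (Metric.ball_mem_nhds (0 : ℝ) one_pos)
    (Eventually.of_forall fun s => h.aestronglyMeasurable_exp_mul lam hψ hM _)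
    (h.integrableOn_exp_mul_ouSemigroup hlam hψ hM _)
    (h.integrableOn_exp_mul_ouDeriv hlam hψ hM v x).aestronglyMeasurable
    (ae_restrict_Ioi fun t ht => ?_)
    ((h.integrableOn_exp_mul_gamBound hlam).mul_const _)
    (ae_restrict_Ioi fun t ht => (h.hasDerivAt_ouSemigroup ht hψ hM v x).const_mul _)).2
  have hN := gamBound_nonneg T V G t
  refine LipschitzOnWith.of_dist_le_mul fun s _ r _ => ?_
  rw [Real.coe_nnabs, abs_of_nonneg (by positivity), dist_eq_norm, dist_eq_norm, ← mul_sub,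
    norm_mul, Real.norm_eq_abs, Real.abs_exp, mul_assoc, mul_assoc, Real.norm_eq_abs,
    Real.norm_eq_abs]
  refine mul_le_mul_of_nonneg_left ?_ (Real.exp_pos _).le
  have h1 := abs_sub_le_of_hasDerivAt (fun v x => h.hasDerivAt_ouSemigroup ht hψ hM v x)
    (fun x => h.abs_ouDeriv_le ht hψ hM v x) x s r
  linarith

/-- Uniform continuity of the directional derivatives of the resolvent, uniformly over directions
in the unit ball. -/
theorem UniquenessHyp.tendsto_resolventDeriv_sub (h : UniquenessHyp T A V G) {lam : ℝ}
    (hlam : 0 < lam) {ψ : H → ℝ} (hψ : IsUCb ψ) :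
    Tendsto (fun q : (H × H) × U => resolventDeriv T V G lam ψ q.2 q.1.1 -
      resolventDeriv T V G lam ψ q.2 q.1.2)
      (uniformity H ×ˢ 𝓟 (Metric.closedBall 0 1)) (𝓝 0) := by
  obtain ⟨hu, M, hM⟩ := id hψ
  have hM0 : 0 ≤ M := (abs_nonneg _).trans (hM 0)
  have hint := fun v x => h.integrableOn_exp_mul_ouDeriv hlam hu.continuous hM v x
  have hball : ∀ᶠ q : (H × H) × U in uniformity H ×ˢ 𝓟 (Metric.closedBall 0 1), ‖q.2‖ ≤ 1 := by
    rw [eventually_prod_principal_iff]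
    exact Eventually.of_forall fun p v hv => by simpa using hv
  have key := tendsto_integral_filter_of_dominated_convergence
    (μ := volume.restrict (Ioi (0 : ℝ)))
    (l := uniformity H ×ˢ 𝓟 (Metric.closedBall (0 : U) 1))
    (F := fun q t => Real.exp (-lam * t) * ouDeriv T V G t ψ q.2 q.1.1 -
      Real.exp (-lam * t) * ouDeriv T V G t ψ q.2 q.1.2) (f := fun _ => 0)
    (fun t => Real.exp (-lam * t) * gamBound T V G t * (2 * M))
    (Eventually.of_forall fun q => ((hint q.2 q.1.1).sub (hint q.2 q.1.2)).aestronglyMeasurable)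
    (hball.mono fun q hq => ae_restrict_Ioi fun t ht => ?_)
    ((h.integrableOn_exp_mul_gamBound hlam).mul_const _)
    (ae_restrict_Ioi fun t ht => ?_)
  · rw [integral_zero] at key
    refine key.congr fun q => ?_
    rw [integral_sub (hint _ _) (hint _ _)]
    rfl
  · have hN : 0 ≤ Real.exp (-lam * t) * gamBound T V G t :=
      mul_nonneg (Real.exp_pos _).le (gamBound_nonneg T V G t)
    have h1 := h.norm_exp_mul_ouDeriv_le lam hu.continuous hM q.2 q.1.1 ht
    have h2 := h.norm_exp_mul_ouDeriv_le lam hu.continuous hM q.2 q.1.2 ht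
    have h3 : ‖q.2‖ * M ≤ M := mul_le_of_le_one_left hM0 hq
    have h4 := mul_le_mul_of_nonneg_left h3 hN
    refine (norm_sub_le _ _).trans ?_
    linarith
  · simpa [mul_sub] using (h.tendsto_ouDeriv_sub ht hψ).const_mul (Real.exp (-lam * t))

theorem UniquenessHyp.continuous_resolventDeriv (h : UniquenessHyp T A V G) {lam : ℝ}
    (hlam : 0 < lam) {ψ : H → ℝ} (hψ : IsUCb ψ) (v : U) :
    Continuous (resolventDeriv T V G lam ψ v) := by
  obtain ⟨hu, M, hM⟩ := id hψ
  have hD := fun v x => h.hasDerivAt_resolvent hlam hu.continuous hM v x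
  -- rescale to a direction in the unit ball
  have hc : (0 : ℝ) < ‖v‖ + 1 := by positivity
  have hv : (‖v‖ + 1)⁻¹ • v ∈ Metric.closedBall (0 : U) 1 := by
    rw [mem_closedBall_zero_iff, norm_smul, norm_inv, Real.norm_of_nonneg hc.le,
      inv_mul_le_iff₀ hc]
    linarith
  have hunit : Continuous (resolventDeriv T V G lam ψ ((‖v‖ + 1)⁻¹ • v)) := by
    refine UniformContinuous.continuous (Metric.uniformContinuous_iff.2 fun ε hε => ?_)
    have h1 := Metric.tendsto_nhds.1 (h.tendsto_resolventDeriv_sub hlam hψ) ε hε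
    rw [eventually_prod_principal_iff] at h1
    obtain ⟨δ, hδ, hδ'⟩ := Metric.mem_uniformity_dist.1 h1
    refine ⟨δ, hδ, fun {a b} hab => ?_⟩
    simpa [Real.dist_eq] using hδ' hab _ hv
  have e : resolventDeriv T V G lam ψ v =
      fun x => (‖v‖ + 1) * resolventDeriv T V G lam ψ ((‖v‖ + 1)⁻¹ • v) x := by
    ext x
    rw [dirDeriv_smul hD, ← mul_assoc, mul_inv_cancel₀ hc.ne', one_mul]
  rw [e]
  exact continuous_const.mul hunit

theorem UniquenessHyp.vGrad_resolvent (h : UniquenessHyp T A V G) {lam : ℝ}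
    (hlam : 0 < lam) {ψ : H → ℝ} (hψ : IsUCb ψ) (x : H) :
    HasVGradAt V (ouResolvent T G lam ψ) (vGrad V (ouResolvent T G lam ψ) x) x ∧
      ∀ v, ⟪vGrad V (ouResolvent T G lam ψ) x, v⟫ = resolventDeriv T V G lam ψ v x := by
  obtain ⟨hu, M, hM⟩ := id hψ
  exact vGrad_of_dirDeriv (fun v x => h.hasDerivAt_resolvent hlam hu.continuous hM v x)
    (h.continuous_resolventDeriv hlam hψ)
    (fun v x => h.abs_resolventDeriv_le hlam hu.continuous hM v x) x

theorem UniquenessHyp.norm_vGrad_resolvent_le (h : UniquenessHyp T A V G) {lam : ℝ}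
    (hlam : 0 < lam) {ψ : H → ℝ} (hψ : IsUCb ψ) {M : ℝ} (hM : ∀ x, |ψ x| ≤ M) (x : H) :
    ‖vGrad V (ouResolvent T G lam ψ) x‖ ≤ gamLaplace T V G lam * M := by
  have hM0 : 0 ≤ M := (abs_nonneg _).trans (hM 0)
  have hC : 0 ≤ gamLaplace T V G lam * M := mul_nonneg (gamLaplace_nonneg T V G lam) hM0
  refine norm_le_of_forall_inner_le hC fun v hv => ?_
  rw [(h.vGrad_resolvent hlam hψ x).2]
  refine (le_abs_self _).trans ((h.abs_resolventDeriv_le hlam hψ.1.continuous hM v x).trans ?_)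
  exact mul_le_of_le_one_right hC hv

theorem UniquenessHyp.isC1bV_resolvent (h : UniquenessHyp T A V G) {lam : ℝ}
    (hlam : 0 < lam) {ψ : H → ℝ} (hψ : IsUCb ψ) : IsC1bV V (ouResolvent T G lam ψ) where
  ucb := h.isUCb_resolvent hlam hψ
  differentiable x := ⟨_, (h.vGrad_resolvent hlam hψ x).1⟩
  grad_ucb := by
    obtain ⟨hu, M, hM⟩ := id hψ
    refine ⟨Metric.uniformContinuous_iff.2 fun ε hε => ?_, _,
      h.norm_vGrad_resolvent_le hlam hψ hM⟩
    have h1 := Metric.tendsto_nhds.1 (h.tendsto_resolventDeriv_sub hlam hψ) (ε / 2) (half_pos hε)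
    rw [eventually_prod_principal_iff] at h1
    obtain ⟨δ, hδ, hδ'⟩ := Metric.mem_uniformity_dist.1 h1
    refine ⟨δ, hδ, fun {a b} hab => ?_⟩
    rw [dist_eq_norm]
    refine lt_of_le_of_lt (norm_le_of_forall_inner_le (half_pos hε).le fun v hv => ?_)
      (half_lt_self hε)
    rw [inner_sub_left, (h.vGrad_resolvent hlam hψ a).2, (h.vGrad_resolvent hlam hψ b).2]
    have h2 := hδ' hab v (by simpa using hv)
    rw [dist_zero_right] at h2
    exact (le_abs_self _).trans h2.le

theorem UniquenessHyp.vGrad_resolvent_sub (h : UniquenessHyp T A V G) {lam : ℝ}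
    (hlam : 0 < lam) {φ ψ : H → ℝ} (hφ : IsUCb φ) (hψ : IsUCb ψ)
    (hsub : IsUCb fun z => φ z - ψ z) (x : H) :
    vGrad V (ouResolvent T G lam φ) x - vGrad V (ouResolvent T G lam ψ) x
      = vGrad V (ouResolvent T G lam fun z => φ z - ψ z) x := by
  have h1 := (h.vGrad_resolvent hlam hψ x).1.add (h.vGrad_resolvent hlam hsub x).1
  have e : (fun x => ouResolvent T G lam ψ x + ouResolvent T G lam (fun z => φ z - ψ z) x)
      = ouResolvent T G lam φ := by
    ext y
    rw [h.resolvent_sub hlam hφ hψ, add_sub_cancel]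
  rw [e] at h1
  rw [h1.vGrad_eq, add_sub_cancel_left]

end Resolvent

/-! ### The fixed point equation -/

section FixedPoint

variable {H U : Type*} [NormedAddCommGroup H] [NormedAddCommGroup U] [InnerProductSpace ℝ U]

theorem IsUCb.sub {φ ψ : H → ℝ} (hφ : IsUCb φ) (hψ : IsUCb ψ) : IsUCb fun z => φ z - ψ z := by
  obtain ⟨hφ, M, hM⟩ := hφ
  obtain ⟨hψ, M', hM'⟩ := hψ
  exact ⟨hφ.sub hψ, M + M', fun x => (norm_sub_le _ _).trans (add_le_add (hM x) (hM' x))⟩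

theorem IsUCb.add {φ ψ : H → ℝ} (hφ : IsUCb φ) (hψ : IsUCb ψ) : IsUCb fun z => φ z + ψ z := by
  obtain ⟨hφ, M, hM⟩ := hφ
  obtain ⟨hψ, M', hM'⟩ := hψ
  exact ⟨hφ.add hψ, M + M', fun x => (norm_add_le _ _).trans (add_le_add (hM x) (hM' x))⟩

theorem IsUCb.inner {p q : H → U} (hp : IsUCb p) (hq : IsUCb q) : IsUCb fun z => ⟪p z, q z⟫ := by
  obtain ⟨hp, M, hM⟩ := hp
  obtain ⟨hq, M', hM'⟩ := hq
  have hM0 : 0 ≤ M := (norm_nonneg _).trans (hM 0)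
  have hM0' : 0 ≤ M' := (norm_nonneg _).trans (hM' 0)
  refine ⟨Metric.uniformContinuous_iff.2 fun ε hε => ?_, M * M', fun x =>
    (norm_inner_le_norm _ _).trans (mul_le_mul (hM x) (hM' x) (norm_nonneg _) hM0)⟩
  set ε' := ε / (M + M' + 1) with hε'
  have hε0 : 0 < ε' := by positivity
  obtain ⟨δ, hδ, hδ'⟩ := Metric.uniformContinuous_iff.1 hp ε' hε0
  obtain ⟨ρ, hρ, hρ'⟩ := Metric.uniformContinuous_iff.1 hq ε' hε0
  refine ⟨min δ ρ, lt_min hδ hρ, fun {a b} hab => ?_⟩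
  have h1 := (hδ' (hab.trans_le (min_le_left _ _))).le
  have h2 := (hρ' (hab.trans_le (min_le_right _ _))).le
  rw [dist_eq_norm] at h1 h2
  have e : ⟪p a, q a⟫ - ⟪p b, q b⟫ = ⟪p a - p b, q a⟫ + ⟪p b, q a - q b⟫ := by
    rw [inner_sub_left, inner_sub_right]; ring
  rw [Real.dist_eq, e]
  refine (abs_add_le _ _).trans_lt ?_
  have h3 := (norm_inner_le_norm (𝕜 := ℝ) (p a - p b) (q a)).trans
    (mul_le_mul h1 (hM' a) (norm_nonneg _) hε0.le)
  have h4 := (norm_inner_le_norm (𝕜 := ℝ) (p b) (q a - q b)).trans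
    (mul_le_mul (hM b) h2 (norm_nonneg _) hM0)
  rw [Real.norm_eq_abs] at h3 h4
  have h5 : (M + M' + 1) * ε' = ε := by rw [hε']; field_simp
  nlinarith

theorem IsUCb.norm_le_supNorm {E F : Type*} [NormedAddCommGroup E] [NormedAddCommGroup F]
    {f : E → F} (hf : IsUCb f) (x : E) : ‖f x‖ ≤ supNorm f := by
  obtain ⟨-, M, hM⟩ := hf
  exact le_ciSup (f := fun x => ‖f x‖) ⟨M, by rintro _ ⟨y, rfl⟩; exact hM y⟩ x

theorem supNorm_le {E F : Type*} [NormedAddCommGroup E] [NormedAddCommGroup F]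
    {f : E → F} {M : ℝ} (hM : ∀ x, ‖f x‖ ≤ M) : supNorm f ≤ M :=
  ciSup_le hM

/-- The contraction principle on the space of bounded uniformly continuous functions. -/
theorem exists_fixedPoint_of_isUCb {Φ : (H → ℝ) → (H → ℝ)} (hΦ : ∀ ψ, IsUCb ψ → IsUCb (Φ ψ))
    (hc : ∀ φ ψ, IsUCb φ → IsUCb ψ → ∀ M, (∀ x, |φ x - ψ x| ≤ M) →
      ∀ x, |Φ φ x - Φ ψ x| ≤ 1 / 2 * M) :
    ∃ ψ, IsUCb ψ ∧ Φ ψ = ψ := by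
  let S : Set (BoundedContinuousFunction H ℝ) := {f | UniformContinuous f}
  have hS : IsClosed S := by
    refine IsSeqClosed.isClosed fun f g hf hg => ?_
    exact (BoundedContinuousFunction.tendsto_iff_tendstoUniformly.1 hg).uniformContinuous
      (Frequently.of_forall hf)
  have hcomp : CompleteSpace S := hS.completeSpace_coe
  have hne : Nonempty S := ⟨⟨0, uniformContinuous_const⟩⟩
  have hUC : ∀ f : S, IsUCb (f : H → ℝ) := fun f => ⟨f.2, ‖f.1‖, fun x => f.1.norm_coe_le_norm x⟩
  let F : S → S := fun f => ⟨BoundedContinuousFunction.ofNormedAddCommGroup (Φ f)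
    (hΦ _ (hUC f)).1.continuous (hΦ _ (hUC f)).2.choose (hΦ _ (hUC f)).2.choose_spec,
    (hΦ _ (hUC f)).1⟩
  have hF : ContractingWith (1 / 2) F := by
    refine ⟨by rw [← NNReal.coe_lt_coe]; norm_num, LipschitzWith.of_dist_le_mul fun f g => ?_⟩
    refine (BoundedContinuousFunction.dist_le (by positivity)).2 fun x => ?_
    have h1 := hc f g (hUC f) (hUC g) (dist f g) (fun y => by
      rw [← Real.dist_eq]; exact BoundedContinuousFunction.dist_coe_le_dist y) x
    rw [Real.dist_eq]
    simpa [F] using h1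
  refine ⟨(ContractingWith.fixedPoint F hF : S), hUC _, ?_⟩
  have h1 := congrArg (fun f : S => (f : H → ℝ)) (hF.fixedPoint_isFixedPt).eq
  exact h1

end FixedPoint

end WeakUniq

theorem mainTheorem8 {H U : Type*}
    [NormedAddCommGroup H] [InnerProductSpace ℝ H] [CompleteSpace H]
    [TopologicalSpace.SeparableSpace H] [MeasurableSpace H] [BorelSpace H]
    [NormedAddCommGroup U] [InnerProductSpace ℝ U] [CompleteSpace U]
    [TopologicalSpace.SeparableSpace U]
    (T : ℝ → H →L[ℝ] H) (A : H →ₗ.[ℝ] H) (V G : U →L[ℝ] H) (B : H → U)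
    (hyp : WeakUniq.UniquenessHyp T A V G) (hB : WeakUniq.IsUCb B) :
    ∃ lam₀ : ℝ, 0 < lam₀ ∧ ∀ lam : ℝ, lam₀ < lam → ∀ g : H → ℝ, WeakUniq.IsUCb g →
      ∃ u : H → ℝ, WeakUniq.IsSolution T V G B lam g u ∧
        (∀ x : H, IntegrableOn (WeakUniq.eqIntegrand T V G B lam g u x) (Ioi 0)) ∧
        WeakUniq.c1bVNorm V u ≤ WeakUniq.supNorm g ∧
        ∀ w : H → ℝ, WeakUniq.IsSolution T V G B lam g w → w = u := by
  open WeakUniq in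
  set b := supNorm B with hb
  have hb0 : 0 ≤ b := (norm_nonneg _).trans (hB.norm_le_supNorm 0)
  have hlim : Tendsto (fun lam : ℝ => gamLaplace T V G lam) atTop (𝓝 0) :=
    hyp.tendsto_integral_exp_mul_gamBound
  have hlim1 : ∀ᶠ lam : ℝ in atTop, gamLaplace T V G lam * b < 1 / 2 :=
    (hlim.mul_const b).eventually_lt_const (by rw [zero_mul]; norm_num)
  have hlim2 : ∀ᶠ lam : ℝ in atTop, lam⁻¹ + gamLaplace T V G lam < 1 / 2 :=
    (tendsto_inv_atTop_zero.add hlim).eventually_lt_const (by norm_num)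
  obtain ⟨l₁, hl₁⟩ := eventually_atTop.1 (hlim1.and hlim2)
  refine ⟨max l₁ 1, by positivity, fun lam hlam g hg => ?_⟩
  have hlam0 : 0 < lam := one_pos.trans ((le_max_right _ _).trans_lt hlam)
  obtain ⟨hC1, hC2⟩ := hl₁ lam ((le_max_left _ _).trans hlam.le)
  have hL0 := gamLaplace_nonneg T V G lam
  -- `u` solves the equation if and only if `ψ = ⟪∇_V u, B⟫ + g` is a fixed point of `Φ`
  let Φ : (H → ℝ) → (H → ℝ) := fun ψ z => ⟪vGrad V (ouResolvent T G lam ψ) z, B z⟫ + g z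
  have hinner : ∀ {p : U} {K : ℝ} (x : H), ‖p‖ ≤ K → |⟪p, B x⟫| ≤ K * b := fun x hp =>
    (abs_real_inner_le_norm _ _).trans
      (mul_le_mul hp (hB.norm_le_supNorm x) (norm_nonneg _) ((norm_nonneg _).trans hp))
  have hΦ : ∀ ψ, IsUCb ψ → IsUCb (Φ ψ) := fun ψ hψ =>
    ((hyp.isC1bV_resolvent hlam0 hψ).grad_ucb.inner hB).add hg
  have hcontr : ∀ φ ψ, IsUCb φ → IsUCb ψ → ∀ M, (∀ x, |φ x - ψ x| ≤ M) →
      ∀ x, |Φ φ x - Φ ψ x| ≤ 1 / 2 * M := by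
    intro φ ψ hφ hψ M hM x
    have hM0 : 0 ≤ M := (abs_nonneg _).trans (hM 0)
    have e : Φ φ x - Φ ψ x = ⟪vGrad V (ouResolvent T G lam fun z => φ z - ψ z) x, B x⟫ := by
      rw [← hyp.vGrad_resolvent_sub hlam0 hφ hψ (hφ.sub hψ), inner_sub_left]
      simp only [Φ]
      ring
    rw [e]
    refine (hinner x (hyp.norm_vGrad_resolvent_le hlam0 (hφ.sub hψ) hM x)).trans ?_
    nlinarith
  obtain ⟨ψ, hψ, hfix⟩ := exists_fixedPoint_of_isUCb hΦ hcontr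
  have hψM : ∀ x, |ψ x| ≤ 2 * supNorm g := by
    have h1 : supNorm ψ ≤ 1 / 2 * supNorm ψ + supNorm g := by
      refine supNorm_le fun x => ?_
      have h2 := hinner x (hyp.norm_vGrad_resolvent_le hlam0 hψ hψ.norm_le_supNorm x)
      have h3 := hg.norm_le_supNorm x
      have h4 : 0 ≤ supNorm ψ := (norm_nonneg _).trans (hψ.norm_le_supNorm x)
      conv_lhs => rw [← hfix]
      refine (norm_add_le _ _).trans (add_le_add (h2.trans ?_) h3)
      nlinarith
    intro x
    have := hψ.norm_le_supNorm x
    rw [Real.norm_eq_abs] at this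
    linarith
  have hg0 : 0 ≤ supNorm g := (norm_nonneg _).trans (hg.norm_le_supNorm 0)
  have hrhs : (fun z => ⟪vGrad V (ouResolvent T G lam ψ) z, B z⟫ + g z) = ψ := hfix
  refine ⟨ouResolvent T G lam ψ, ⟨hyp.isC1bV_resolvent hlam0 hψ, fun x => ?_⟩, fun x => ?_, ?_,
    fun w hw => ?_⟩
  · simp only [eqIntegrand, hrhs]
    rfl
  · have := hyp.integrableOn_exp_mul_ouSemigroup hlam0 hψ.1.continuous hψM x
    unfold eqIntegrand
    rwa [hrhs]
  · have h1 : supNorm (ouResolvent T G lam ψ) ≤ lam⁻¹ * (2 * supNorm g) :=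
      supNorm_le (hyp.abs_resolvent_le hlam0 hψM)
    have h2 : supNorm (vGrad V (ouResolvent T G lam ψ)) ≤ gamLaplace T V G lam * (2 * supNorm g) :=
      supNorm_le (hyp.norm_vGrad_resolvent_le hlam0 hψ hψM)
    rw [c1bVNorm]
    nlinarith
  · -- the right-hand side produced by any solution is a fixed point of `Φ`
    obtain ⟨hw1, hw2⟩ := hw
    set φ : H → ℝ := fun z => ⟪vGrad V w z, B z⟫ + g z with hφdef
    have hφ : IsUCb φ := (hw1.grad_ucb.inner hB).add hg
    have hwφ : w = ouResolvent T G lam φ := funext hw2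
    have hφfix : Φ φ = φ := by
      simp only [Φ]
      rw [← hwφ]
    have hsub := hφ.sub hψ
    have h1 : supNorm (fun z => φ z - ψ z) ≤ 1 / 2 * supNorm (fun z => φ z - ψ z) := by
      refine supNorm_le fun x => ?_
      have := hcontr φ ψ hφ hψ _ hsub.norm_le_supNorm x
      rwa [hφfix, hfix] at this
    have hφψ : φ = ψ := by
      ext x
      have h2 := hsub.norm_le_supNorm x
      have h3 : ‖φ x - ψ x‖ ≤ 0 := by linarith
      exact sub_eq_zero.1 (norm_le_zero_iff.1 h3)
    rw [hwφ, hφψ]
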